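/- Let $d\ge 0$ and let $F:\mathbb R\to\mathbb R$, $G_j:\mathbb R\to\mathbb R$ ($j\in\mathbb Z^d\setminus\{0\}$) satisfy: (A) $F\in C^2(\mathbb R)$, $F(0)=0$, $F''\ge\varepsilon$ for some $\varepsilon>0$, and $|F(x)|\le c\,e^{a|x|}$ for some constants $c,a$ and all $x$; (B) $G_j\in C^2(\mathbb R)$, $G_j(0)=0$, $G_j''\ge 0$ for all $j\ne0$, and there is $r_0$ with $G_j\equiv 0$ whenever $|j|>r_0$; (C) $c_j:=\sup_{x,y\in\mathbb R}\dfrac{|G_j''(x-y)|}{\sqrt{F''(x)}\sqrt{F''(y)}}<\infty$ for all $j\ne0$. For $\lambda\ge0$, a finite $\Lambda\subset\mathbb Z^d$ and a boundary condition $y\in\mathbb R^{\mathbb Z^d}$, let $\mu_\Lambda$ be the probability measure on $\mathbb R^\Lambda$ with density $Z_\Lambda^{-1}e^{-\lambda U_\Lambda(x)}\prod_{k\in\Lambda}e^{-F(x_k)}$ with respect to $\prod_{k\in\Lambda}dx_k$, where $x_k=y_k$ for $k\notin\Lambda$ and $$U_\Lambda(x)=\sum_{k\in\Lambda,\,j\notin\Lambda}G_{k-j}(x_k-x_j)+\tfrac12\sum_{k,j\in\Lambda,\,k\ne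 j}G_{k-j}(x_k-x_j)$$ (so that, when $G_{-j}(-u)=G_j(u)$, each pair $\{k,j\}$ meeting $\Lambda$ is counted once). Let $\mathcal G_\lambda$ be the set of probability measures $\mu$ on $\mathbb R^{\mathbb Z^d}$ with $\mu(\mu_\Lambda(f))=\mu(f)$ for all finite $\Lambda$ and all bounded continuous cylinder functions $f$. Put $\rho(x,y)=\int_x^y\sqrt{F''(s)}\,ds$ and $m_\mu=\sup_{k\in\mathbb Z^d}\int\rho^2(x_k,0)\,d\mu$. Let $d(\cdot,\cdot)$ be a translation invariant semimetric on $\mathbb Z^d$ (symmetric, $d(k,k)=0$, with the triangle inequality; distinct points may have distance $0$), and put $\gamma_d=\sum_{k\ne0}e^{d(k,0)}c_k$. Let $0\le\lambda<1/\gamma_d$ (any $\lambda\ge0$ if $\gamma_d=0$), and suppose that some $\mu\in\mathcal G_\lambda$ has $m_\mu<\infty$. Then the measure $\mu\in\mathcal G_\lambda$ with $m_\mu<\infty$ is unique, and it has exponentially decaying correlations: $$\sum_{k\in\mathbb Z^d}e^{d(k,0)}\,|\mathrm{cov}_\mu(f,\tau_kg)|\le\frac1{1-\lambda\gamma_d}\Big(\sum_{k\in\mathbb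 Z^d}e^{d(k,0)}\delta_k(f)\Big)\Big(\sum_{j\in\mathbb Z^d}e^{d(j,0)}\delta_j(g)\Big)$$ for all bounded $C^1$ cylinder functions $f,g$ on $\mathbb R^{\mathbb Z^d}$ for which both sums on the right are finite, where $\delta_k(f)=\sup_{x}\big|\partial f/\partial x_k(x)\big|/\sqrt{F''(x_k)}$ and $(\tau_kg)(x)=g\big((x_{j+k})_{j}\big)$. -/

import Mathlib

open MeasureTheory
open scoped ENNReal

noncomputable section

namespace LatticeGibbs

/-- The `d`-dimensional integer lattice. -/
abbrev Site (d : ℕ) : Type := Fin d → ℤ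

/-- Spin configurations `x = (x_k)`, with the product topology and product sigma-algebra. -/
abbrev Config (d : ℕ) : Type := Site d → ℝ

/-- The second derivative of a function of one real variable. -/
def second (h : ℝ → ℝ) (x : ℝ) : ℝ := deriv (deriv h) x

/-- Condition A on the self-action `F`. -/
structure ConditionA (F : ℝ → ℝ) : Prop where
  contDiff : ContDiff ℝ 2 F
  zero : F 0 = 0
  convex : ∃ ε : ℝ, 0 < ε ∧ ∀ x, ε ≤ second F x
  growth : ∃ c a : ℝ, ∀ x, |F x| ≤ c * Real.exp (a * |x|)

/-- Condition B on the interactions `G j`, `j ≠ 0` (the value `G 0` is never used). -/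
structure ConditionB {d : ℕ} (G : Site d → ℝ → ℝ) : Prop where
  contDiff : ∀ j, j ≠ 0 → ContDiff ℝ 2 (G j)
  zero : ∀ j, j ≠ 0 → G j 0 = 0
  convex : ∀ j, j ≠ 0 → ∀ x, 0 ≤ second (G j) x
  range : ∃ r : ℝ, ∀ j, j ≠ 0 → r < ‖j‖ → ∀ x, G j x = 0

/-- `sup_{x,y} |G_j''(x - y)| / (√F''(x) √F''(y))`, possibly infinite. -/
def coupling {d : ℕ} (F : ℝ → ℝ) (G : Site d → ℝ → ℝ) (j : Site d) : ℝ≥0∞ :=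
  ⨆ (x : ℝ) (y : ℝ),
    ENNReal.ofReal (|second (G j) (x - y)| / (√(second F x) * √(second F y)))

/-- Condition C: the interaction is dominated by the self-action. -/
def ConditionC {d : ℕ} (F : ℝ → ℝ) (G : Site d → ℝ → ℝ) : Prop :=
  ∀ j, j ≠ 0 → coupling F G j < ∞

/-- Translation invariant semimetrics on the lattice. -/
structure IsInvariantSemimetric {d : ℕ} (D : Site d → Site d → ℝ) : Prop where
  self : ∀ k, D k k = 0
  symm : ∀ k j, D k j = D j k
  triangle : ∀ k j i, D k i ≤ D k j + D j i
  translate : ∀ k j i, D (k + i) (j + i) = D k j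

/-- `e^{D(k,0)}`. -/
def expWeight {d : ℕ} (D : Site d → Site d → ℝ) (k : Site d) : ℝ≥0∞ :=
  ENNReal.ofReal (Real.exp (D k 0))

/-- The constant `γ = ∑_{k ≠ 0} e^{D(k,0)} sup_{x,y} |G_k''(x - y)| / (√F''(x) √F''(y))`. -/
def gammaConst {d : ℕ} (F : ℝ → ℝ) (G : Site d → ℝ → ℝ)
    (D : Site d → Site d → ℝ) : ℝ≥0∞ :=
  ∑' k : {k : Site d // k ≠ 0}, expWeight D k * coupling F G k

/-- The sum of `G_{k-j}(x_k - x_j)` over the pairs `{k, j}`, `k ≠ j`, that meet `Λ`, each counted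
once: pairs with exactly one point `k` in `Λ`, and pairs inside `Λ`, where the ordered sum counts
every pair twice. For `Λ = {k}` this is `∑_{j ≠ k} G_{k-j}(x_k - x_j)`. -/
def interactionEnergy {d : ℕ} (G : Site d → ℝ → ℝ) (Λ : Finset (Site d))
    (x : Config d) : ℝ :=
  (∑ k ∈ Λ, ∑' j : {j : Site d // j ∉ Λ}, G (k - j) (x k - x j))
    + (1 / 2) * ∑ k ∈ Λ, ∑ j ∈ Λ.erase k, G (k - j) (x k - x j)

/-- The unnormalized density `exp(-lam ∑ G_{k-j}(x_k - x_j)) ∏_{k ∈ Λ} exp(-F(x_k))`. -/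
def gibbsDensity {d : ℕ} (F : ℝ → ℝ) (G : Site d → ℝ → ℝ) (lam : ℝ)
    (Λ : Finset (Site d)) (x : Config d) : ℝ :=
  Real.exp (-(lam * interactionEnergy G Λ x)) * ∏ k ∈ Λ, Real.exp (-F (x k))

/-- The expectation `μ_Λ(f)` in the finite volume `Λ`, as a function of the boundary
condition `y`. -/
def localExpectation {d : ℕ} (F : ℝ → ℝ) (G : Site d → ℝ → ℝ) (lam : ℝ)
    (Λ : Finset (Site d)) (f : Config d → ℝ) (y : Config d) : ℝ :=
  (∫ z : Λ → ℝ, f (Function.updateFinset y Λ z) *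
      gibbsDensity F G lam Λ (Function.updateFinset y Λ z)) /
    ∫ z : Λ → ℝ, gibbsDensity F G lam Λ (Function.updateFinset y Λ z)

/-- Bounded continuous cylinder functions. -/
def IsCbCyl {d : ℕ} (f : Config d → ℝ) : Prop :=
  (∃ (s : Finset (Site d)) (φ : (s → ℝ) → ℝ), Continuous φ ∧
    ∀ x : Config d, f x = φ (fun k => x k)) ∧ ∃ M : ℝ, ∀ x, |f x| ≤ M

/-- Bounded continuously differentiable cylinder functions. -/
def IsC1bCyl {d : ℕ} (f : Config d → ℝ) : Prop :=
  (∃ (s : Finset (Site d)) (φ : (s → ℝ) → ℝ), ContDiff ℝ 1 φ ∧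
    ∀ x : Config d, f x = φ (fun k => x k)) ∧ ∃ M : ℝ, ∀ x, |f x| ≤ M

/-- Gibbs measures: probability measures with `μ(μ_Λ(f)) = μ(f)` for every finite `Λ` and every
bounded continuous cylinder function `f`. -/
structure IsGibbs {d : ℕ} (F : ℝ → ℝ) (G : Site d → ℝ → ℝ) (lam : ℝ)
    (μ : Measure (Config d)) : Prop where
  prob : IsProbabilityMeasure μ
  dlr : ∀ (Λ : Finset (Site d)) (f : Config d → ℝ), IsCbCyl f →
    ∫ y, localExpectation F G lam Λ f y ∂μ = ∫ x, f x ∂μ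

/-- `ρ(x, y) = ∫_x^y √F''(s) ds`. -/
def rho (F : ℝ → ℝ) (x y : ℝ) : ℝ := ∫ s in x..y, √(second F s)

/-- `m_μ = sup_k ∫ ρ²(x_k, 0) dμ`, possibly infinite. -/
def moment {d : ℕ} (F : ℝ → ℝ) (μ : Measure (Config d)) : ℝ≥0∞ :=
  ⨆ k : Site d, ∫⁻ x, ENNReal.ofReal (rho F (x k) 0 ^ 2) ∂μ

/-- The partial derivative `∂f/∂x_k`. -/
def partialDeriv {d : ℕ} (k : Site d) (f : Config d → ℝ) (x : Config d) : ℝ :=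
  deriv (fun t : ℝ => f (Function.update x k t)) (x k)

/-- `δ_k(f) = sup_x |∂_k f(x)| / √F''(x_k)`, possibly infinite. -/
def oscillation {d : ℕ} (F : ℝ → ℝ) (k : Site d) (f : Config d → ℝ) : ℝ≥0∞ :=
  ⨆ x : Config d, ENNReal.ofReal (|partialDeriv k f x| / √(second F (x k)))

/-- `∑_k e^{D(k,0)} δ_k(f)`. -/
def weightedOsc {d : ℕ} (F : ℝ → ℝ) (D : Site d → Site d → ℝ)
    (f : Config d → ℝ) : ℝ≥0∞ :=
  ∑' k : Site d, expWeight D k * oscillation F k f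

/-- The shift `(τ_k g)(x) = g((x_{j+k})_j)`. -/
def shift {d : ℕ} (k : Site d) (g : Config d → ℝ) (x : Config d) : ℝ :=
  g (fun j => x (j + k))

end LatticeGibbs

end

open LatticeGibbs

/-! The proof is Dobrushin's uniqueness argument, with the distance `|ρ|` on the spin space, in a
form that only uses the one-site conditional expectations `E_k`.

*One spin.* Given the other spins, the spin at `k` has density proportional to `e^{-V}` with `V - F`
convex. Writing `len t = ρ(0, t)`, the Cauchy–Schwarz inequality gives
`(len x - len c)² ≤ (x - c) (F'(x) - F'(c)) ≤ (x - c) (V'(x) - V'(c))`, and for `c` the mean position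
the right-hand side has expectation `1`, by an integration by parts
(`IsConvexPerturbation.exists_integral_sq_len_le`). Hence functions that are Lipschitz with constants
`a`, `b` for `|ρ|` have covariance at most `a b` (`LenLipschitz.abs_covariance_le`), and, by
interpolating linearly between two potentials whose difference is `b`-Lipschitz, the corresponding
expectations of an `a`-Lipschitz function differ by at most `a b` (`LenLipschitz.abs_integral_sub_le`).
By condition (C), moving the spin at `j` perturbs the potential at `k` by a Lipschitz function, so
`E_k` turns the constants `a_j` into `a_j + κ_{k-j} a_k` for `j ≠ k`, and `a_k` into `0`, where
`κ = λ c` (`IsDominated.isLipCyl_siteMean`).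

*Averaging.* Let `P` be the average of the `E_k` over a finite set `Λ` with `N` elements. Replacing
`P^m g` by `P^{m+1} g` in `μ(f P^m g)` costs `N⁻¹` times the sum over `k ∈ Λ` of the mean conditional
covariances of `f` and `P^m g` at `k`, hence at most `N⁻¹ ∑_{k ∈ Λ} δ_k(f) δ_k(P^m g)`. The
accumulated constants `N⁻¹ ∑_{m < n} δ_k(P^m g)` satisfy a linear recursion
(`iterate_averagedLip_add`) that keeps them below the Neumann series of the matrix `κ`, applied to
`δ(g)` (`accumulatedLip_le`). When `Λ` and `n` are large, the total Lipschitz constant of `P^n g` is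
small (`exists_tsum_iterate_averagedLip_le`), and since `m_μ` is finite, `P^n g` is then almost
constant in mean. This yields both the uniqueness of `μ` (`IsDominated.eq_of_isGibbs`) and the
covariance estimate by the Neumann series (`IsDominated.ofReal_abs_covariance_le`). Summing that over
translates with the weights `e^{D(k,0)}` gives the geometric series of `λ γ`
(`tsum_weight_mul_dobrushinSeries_le`).

Lipschitz constants for `|ρ|` replace suprema of derivatives throughout, so that conditional
expectations need not be differentiated with respect to the boundary condition. -/

noncomputable section

namespace LatticeGibbs

open Set Filter Topology
open scoped NNReal

/-! ### The intrinsic length of the self-action -/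

/-- The signed intrinsic length `∫_0^t √F''` of `[0, t]`, so that
`ρ(x, y) = len F y - len F x`. -/
def len (F : ℝ → ℝ) (t : ℝ) : ℝ := ∫ s in (0 : ℝ)..t, √(second F s)

section Len

variable {F : ℝ → ℝ} (hA : ConditionA F)

include hA

lemma ConditionA.second_pos (x : ℝ) : 0 < second F x := by
  obtain ⟨ε, hε, h⟩ := hA.convex
  exact hε.trans_le (h x)

lemma ConditionA.hasDerivAt (x : ℝ) : HasDerivAt F (deriv F x) x :=
  (hA.contDiff.differentiable (by norm_num) x).hasDerivAt

end Len

lemma contDiff_deriv_of_two {h : ℝ → ℝ} (hh : ContDiff ℝ 2 h) : ContDiff ℝ 1 (deriv h) :=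
  (contDiff_succ_iff_deriv.1 (show ContDiff ℝ (1 + 1) h from hh)).2.2

lemma hasDerivAt_deriv_second {h : ℝ → ℝ} (hh : ContDiff ℝ 2 h) (x : ℝ) :
    HasDerivAt (deriv h) (second h x) x :=
  ((contDiff_deriv_of_two hh).differentiable (by norm_num) x).hasDerivAt

lemma continuous_second {h : ℝ → ℝ} (hh : ContDiff ℝ 2 h) : Continuous (second h) :=
  (contDiff_deriv_of_two hh).continuous_deriv (by norm_num)

section Len

variable {F : ℝ → ℝ} (hA : ConditionA F)

include hA

lemma hasDerivAt_len (x : ℝ) : HasDerivAt (len F) (√(second F x)) x := by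
  have hc : Continuous fun s => √(second F s) := (continuous_second hA.contDiff).sqrt
  exact intervalIntegral.integral_hasDerivAt_right (hc.intervalIntegrable _ _)
    hc.aestronglyMeasurable.stronglyMeasurableAtFilter hc.continuousAt

lemma continuous_len : Continuous (len F) :=
  continuous_iff_continuousAt.2 fun x => (hasDerivAt_len hA x).continuousAt

lemma monotone_len : Monotone (len F) :=
  monotone_of_hasDerivAt_nonneg (hasDerivAt_len hA) fun _ => Real.sqrt_nonneg _

omit hA in
lemma len_zero : len F 0 = 0 := by simp [len]

lemma rho_eq (x y : ℝ) : rho F x y = len F y - len F x := by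
  have hc : Continuous fun s => √(second F s) := (continuous_second hA.contDiff).sqrt
  rw [rho, len, len, intervalIntegral.integral_interval_sub_left] <;>
    exact hc.intervalIntegrable _ _

lemma abs_sub_le_len_of_hasDerivAt {φ φ' : ℝ → ℝ} {A : ℝ} (hφ : ∀ s, HasDerivAt φ (φ' s) s)
    (hb : ∀ s, |φ' s| ≤ A * √(second F s)) (x y : ℝ) :
    |φ x - φ y| ≤ A * |len F x - len F y| := by
  have h1 : Monotone fun s => A * len F s - φ s :=
    monotone_of_hasDerivAt_nonneg (fun s => ((hasDerivAt_len hA s).const_mul A).sub (hφ s))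
      fun s => by simpa using (le_abs_self _).trans (hb s)
  have h2 : Monotone fun s => A * len F s + φ s :=
    monotone_of_hasDerivAt_nonneg (fun s => ((hasDerivAt_len hA s).const_mul A).add (hφ s))
      fun s => by have := (neg_le_abs _).trans (hb s); simp only [Pi.zero_apply]; linarith
  wlog hxy : y ≤ x generalizing x y
  · rw [abs_sub_comm, abs_sub_comm (len F x)]
    exact this y x (le_of_not_ge hxy)
  have e1 := h1 hxy
  have e2 := h2 hxy
  simp only at e1 e2
  rw [abs_of_nonneg (sub_nonneg.2 (monotone_len hA hxy)), abs_le]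
  constructor <;> linarith

/-- Lipschitz functions are Lipschitz for the intrinsic length, since `F''` is bounded below. -/
lemma exists_abs_sub_le_len : ∃ C : ℝ≥0, ∀ x y : ℝ, |x - y| ≤ C * |len F x - len F y| := by
  obtain ⟨ε, hε, h⟩ := hA.convex
  refine ⟨(NNReal.sqrt ε.toNNReal)⁻¹, fun x y => ?_⟩
  refine abs_sub_le_len_of_hasDerivAt hA (φ := fun s => s) (φ' := fun _ => 1)
    (fun s => hasDerivAt_id s)
    (fun s => ?_) x y
  have h1 : 0 < √ε := Real.sqrt_pos.2 hε
  rw [abs_one, NNReal.coe_inv, Real.coe_sqrt, Real.coe_toNNReal _ hε.le, inv_mul_eq_div,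
    le_div_iff₀ h1, one_mul]
  exact Real.sqrt_le_sqrt (h s)

/-- The squared length is dominated by the increments of `F'`: this is the Cauchy–Schwarz
inequality for `∫ √F''`. -/
lemma sq_len_sub_le (x y : ℝ) :
    (len F x - len F y) ^ 2 ≤ (x - y) * (deriv F x - deriv F y) := by
  wlog hxy : y ≤ x generalizing x y
  · have := this y x (le_of_not_ge hxy)
    nlinarith
  rcases hxy.eq_or_lt with rfl | hlt
  · simp
  -- `∫ (√F'' - θ)² ≥ 0`, with `θ` the mean of `√F''` over `[y, x]`
  set θ := (len F x - len F y) / (x - y) with hθ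
  have hm : Monotone fun s => deriv F s - 2 * θ * len F s + θ ^ 2 * s := by
    refine monotone_of_hasDerivAt_nonneg (f' := fun s => (√(second F s) - θ) ^ 2)
      (fun s => ?_) fun s => sq_nonneg _
    have := ((hasDerivAt_deriv_second hA.contDiff s).sub
      ((hasDerivAt_len hA s).const_mul (2 * θ))).add ((hasDerivAt_id s).const_mul (θ ^ 2))
    refine this.congr_deriv ?_
    rw [sub_sq, Real.sq_sqrt (hA.second_pos s).le]; ring
  have := hm hxy
  simp only at this
  have hx : 0 < x - y := sub_pos.2 hlt
  have hL : len F x - len F y = θ * (x - y) := by rw [hθ]; field_simp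
  have h2 : deriv F x - deriv F y ≥ θ ^ 2 * (x - y) := by
    have h3 : θ * (len F x - len F y) = θ ^ 2 * (x - y) := by rw [hL]; ring
    linarith
  rw [hL]
  nlinarith

end Len

/-! ### Convex perturbations of the self-action on the line -/

/-- `V` is a convex perturbation of `F`: `V - F` is convex, expressed through the first
derivatives. -/
structure IsConvexPerturbation (F V : ℝ → ℝ) : Prop where
  differentiable : Differentiable ℝ V
  monotone : Monotone fun x => deriv V x - deriv F x

section Pert

variable {F V : ℝ → ℝ} (hA : ConditionA F) (hV : IsConvexPerturbation F V)

include hA hV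

lemma IsConvexPerturbation.exists_strong_monotone :
    ∃ ε : ℝ, 0 < ε ∧ ∀ x y, y ≤ x → ε * (x - y) ≤ deriv V x - deriv V y := by
  obtain ⟨ε, hε, h⟩ := hA.convex
  refine ⟨ε, hε, fun x y hxy => ?_⟩
  have hm : Monotone fun s => deriv F s - ε * s :=
    monotone_of_hasDerivAt_nonneg (fun s => (hasDerivAt_deriv_second hA.contDiff s).sub
      ((hasDerivAt_id s).const_mul ε)) fun s => by simpa using h s
  have h1 := hm hxy
  have h2 := hV.monotone hxy
  simp only at h1 h2
  linarith

lemma IsConvexPerturbation.monotone_deriv : Monotone (deriv V) := fun y x hxy => by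
  obtain ⟨ε, hε, h⟩ := hV.exists_strong_monotone hA
  nlinarith [h x y hxy, mul_nonneg hε.le (sub_nonneg.2 hxy)]

lemma IsConvexPerturbation.sq_len_sub_le (x y : ℝ) :
    (len F x - len F y) ^ 2 ≤ (x - y) * (deriv V x - deriv V y) := by
  refine (LatticeGibbs.sq_len_sub_le hA x y).trans ?_
  rcases le_total y x with h | h <;> have := hV.monotone h <;> simp only at this <;> nlinarith

lemma IsConvexPerturbation.exp_neg_le :
    ∃ C β : ℝ, 0 < C ∧ 0 < β ∧ ∀ x, Real.exp (-V x) ≤ C * Real.exp (-β * x ^ 2) := by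
  obtain ⟨ε, hε, h⟩ := hV.exists_strong_monotone hA
  have hq : ∀ x, V 0 + deriv V 0 * x + ε / 2 * x ^ 2 ≤ V x := by
    intro x
    set φ : ℝ → ℝ := fun s => V s - deriv V 0 * s - ε / 2 * s ^ 2 with hφ
    have hd : ∀ s, HasDerivAt φ (deriv V s - deriv V 0 - ε * s) s := by
      intro s
      have := ((hV.differentiable s).hasDerivAt.sub ((hasDerivAt_id s).const_mul (deriv V 0))).sub
        ((hasDerivAt_pow 2 s).const_mul (ε / 2))
      refine this.congr_deriv ?_
      simp; ring
    have hsgn : ∀ s, 0 ≤ s → 0 ≤ deriv V s - deriv V 0 - ε * s := fun s hs => by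
      have := h s 0 hs; linarith
    have hsgn' : ∀ s, s ≤ 0 → deriv V s - deriv V 0 - ε * s ≤ 0 := fun s hs => by
      have := h 0 s hs; linarith
    have key : φ 0 ≤ φ x := by
      rcases lt_trichotomy x 0 with hx | hx | hx
      · obtain ⟨c, hc, e⟩ := exists_hasDerivAt_eq_slope φ _ hx
          (fun s _ => (hd s).continuousAt.continuousWithinAt) (fun s _ => hd s)
        have := hsgn' c hc.2.le
        rw [e, div_nonpos_iff] at this
        rcases this with h | h <;> linarith [h.1, h.2]
      · rw [hx]
      · obtain ⟨c, hc, e⟩ := exists_hasDerivAt_eq_slope φ _ hx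
          (fun s _ => (hd s).continuousAt.continuousWithinAt) (fun s _ => hd s)
        have := hsgn c hc.1.le
        rw [e, div_nonneg_iff] at this
        rcases this with h | h <;> linarith [h.1, h.2]
    simp only [hφ] at key
    nlinarith
  refine ⟨Real.exp (-V 0 + deriv V 0 ^ 2 / ε), ε / 4, Real.exp_pos _, by positivity, fun x => ?_⟩
  rw [← Real.exp_add]
  refine Real.exp_le_exp.2 ?_
  have h1 := hq x
  have h2 : 0 ≤ (deriv V 0 + ε / 2 * x) ^ 2 / ε := by positivity
  have h3 : (deriv V 0 + ε / 2 * x) ^ 2 / ε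
      = deriv V 0 ^ 2 / ε + deriv V 0 * x + ε / 4 * x ^ 2 := by field_simp; ring
  linarith

lemma IsConvexPerturbation.integrable_exp_neg : Integrable fun x => Real.exp (-V x) := by
  obtain ⟨C, β, hC, hβ, h⟩ := hV.exp_neg_le hA
  refine ((integrable_exp_neg_mul_sq hβ).const_mul C).mono'
    (hV.differentiable.continuous.neg.rexp).aestronglyMeasurable (ae_of_all _ fun x => ?_)
  rw [Real.norm_eq_abs, Real.abs_exp]
  exact h x

lemma IsConvexPerturbation.integrable_mul_exp_neg :
    Integrable fun x => x * Real.exp (-V x) := by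
  obtain ⟨C, β, hC, hβ, h⟩ := hV.exp_neg_le hA
  refine ((integrable_mul_exp_neg_mul_sq hβ).norm.const_mul C).mono'
    (continuous_id.mul hV.differentiable.continuous.neg.rexp).aestronglyMeasurable
    (ae_of_all _ fun x => ?_)
  rw [norm_mul, norm_mul, Real.norm_eq_abs (Real.exp _), Real.abs_exp,
    Real.norm_eq_abs (Real.exp _), Real.abs_exp]
  calc ‖x‖ * Real.exp (-V x) ≤ ‖x‖ * (C * Real.exp (-β * x ^ 2)) := by gcongr; exact h x
    _ = _ := by ring

lemma IsConvexPerturbation.exists_abs_mul_exp_neg_le :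
    ∃ K : ℝ, ∀ x, |x| * Real.exp (-V x) ≤ K := by
  obtain ⟨C, β, hC, hβ, h⟩ := hV.exp_neg_le hA
  refine ⟨C * (1 + β⁻¹), fun x => ?_⟩
  have h1 : |x| ≤ (1 + β⁻¹) * Real.exp (β * x ^ 2) := by
    have h2 := Real.add_one_le_exp (β * x ^ 2)
    have h3 : |x| ≤ 1 + x ^ 2 := by nlinarith [sq_abs x, sq_nonneg (|x| - 1)]
    have h4 : (1 + β⁻¹) * (β * x ^ 2 + 1) = 1 + x ^ 2 + β * x ^ 2 + β⁻¹ := by field_simp; ring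
    have h5 : 0 < β⁻¹ := by positivity
    have h6 : 0 ≤ β * x ^ 2 := by positivity
    calc |x| ≤ (1 + β⁻¹) * (β * x ^ 2 + 1) := by linarith
      _ ≤ _ := by gcongr
  calc |x| * Real.exp (-V x)
      ≤ ((1 + β⁻¹) * Real.exp (β * x ^ 2)) * (C * Real.exp (-β * x ^ 2)) := by
        gcongr; exact h x
    _ = C * (1 + β⁻¹) * (Real.exp (β * x ^ 2) * Real.exp (-β * x ^ 2)) := by ring
    _ = C * (1 + β⁻¹) := by rw [← Real.exp_add]; simp

omit hA in
lemma IsConvexPerturbation.hasDerivAt_exp_neg (x : ℝ) :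
    HasDerivAt (fun x => Real.exp (-V x)) (-(deriv V x * Real.exp (-V x))) x := by
  have := (hV.differentiable x).hasDerivAt.neg.exp
  exact this.congr_deriv (by simp; ring)

/-- `x (V'(x) - V'(0)) e^{-V}` is nonnegative and, up to integrable terms, the derivative of the
bounded function `-x e^{-V}`. -/
lemma IsConvexPerturbation.integrable_mul_deriv_sub :
    Integrable fun x => x * (deriv V x - deriv V 0) * Real.exp (-V x) := by
  obtain ⟨K, hK⟩ := hV.exists_abs_mul_exp_neg_le hA
  have hp := hV.integrable_exp_neg hA
  have hxp := hV.integrable_mul_exp_neg hA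
  have hcont : Continuous fun x => Real.exp (-V x) := hV.differentiable.continuous.neg.rexp
  have hmd := hV.monotone_deriv hA
  set q : ℝ → ℝ := fun x => Real.exp (-V x) - deriv V 0 * (x * Real.exp (-V x)) with hq
  have hqi : Integrable q := hp.sub (hxp.const_mul _)
  set u' : ℝ → ℝ := fun x => x * deriv V x * Real.exp (-V x) - Real.exp (-V x) with hu'
  have hu : ∀ x, HasDerivAt (fun x => -(x * Real.exp (-V x))) (u' x) x := by
    intro x
    have := ((hasDerivAt_id x).mul (hV.hasDerivAt_exp_neg x)).neg
    refine this.congr_deriv ?_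
    simp [hu']; ring
  have hii : ∀ a b, IntervalIntegrable u' volume a b := by
    intro a b
    refine IntervalIntegrable.sub ?_ (hcont.intervalIntegrable _ _)
    have h1 : IntervalIntegrable (deriv V) volume a b := (hmd.monotoneOn _).intervalIntegrable
    have := h1.mul_continuousOn (continuous_id.mul hcont).continuousOn
    refine this.congr fun x _ => ?_
    simp; ring
  have hw : ∀ x, x * (deriv V x - deriv V 0) * Real.exp (-V x) = u' x + q x := by
    intro x; simp only [hu', hq]; ring
  have hnn : ∀ x, 0 ≤ x * (deriv V x - deriv V 0) * Real.exp (-V x) := by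
    intro x
    refine mul_nonneg ?_ (Real.exp_pos _).le
    rcases le_total 0 x with h | h
    · exact mul_nonneg h (sub_nonneg.2 (hmd h))
    · exact mul_nonneg_of_nonpos_of_nonpos h (sub_nonpos.2 (hmd h))
  have hwi : ∀ a b, IntervalIntegrable (fun x => x * (deriv V x - deriv V 0) * Real.exp (-V x))
      volume a b := by
    intro a b
    simp_rw [hw]
    exact (hii a b).add hqi.intervalIntegrable
  refine integrable_of_intervalIntegral_norm_bounded (l := atTop) (a := fun n : ℕ => -(n : ℝ))
    (b := fun n : ℕ => (n : ℝ)) (2 * K + ∫ x, ‖q x‖) (fun n => ?_)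
    (tendsto_neg_atTop_atBot.comp tendsto_natCast_atTop_atTop) tendsto_natCast_atTop_atTop
    (Eventually.of_forall fun n => ?_)
  · have h : -(n : ℝ) ≤ n := by linarith [n.cast_nonneg (α := ℝ)]
    exact (intervalIntegrable_iff_integrableOn_Ioc_of_le h).1 (hwi _ _)
  · have h : -(n : ℝ) ≤ n := by linarith [n.cast_nonneg (α := ℝ)]
    simp_rw [Real.norm_of_nonneg (hnn _), hw]
    rw [intervalIntegral.integral_add (hii _ _) hqi.intervalIntegrable,
      intervalIntegral.integral_eq_sub_of_hasDerivAt (fun x _ => hu x) (hii _ _)]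
    have e1 := hK n
    have e2 := hK (-n)
    rw [abs_of_nonneg n.cast_nonneg] at e1
    rw [abs_neg, abs_of_nonneg n.cast_nonneg] at e2
    have e3 : ∫ x in (-(n : ℝ))..n, q x ≤ ∫ x, ‖q x‖ := by
      refine (le_abs_self _).trans ((intervalIntegral.abs_integral_le_integral_abs h).trans ?_)
      rw [intervalIntegral.integral_of_le h]
      exact setIntegral_le_integral hqi.norm (ae_of_all _ fun x => norm_nonneg (q x))
    have e4 : 0 ≤ n * Real.exp (-V n) := by positivity
    have e5 : 0 ≤ n * Real.exp (-V (-n)) := by positivity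
    linarith

lemma IsConvexPerturbation.integrable_deriv_sub :
    Integrable fun x => (deriv V x - deriv V 0) * Real.exp (-V x) := by
  have hmd := hV.monotone_deriv hA
  have hcont : Continuous fun x => Real.exp (-V x) := hV.differentiable.continuous.neg.rexp
  set K := deriv V 1 - deriv V (-1) with hK
  refine (((hV.integrable_exp_neg hA).const_mul K).add (hV.integrable_mul_deriv_sub hA)).mono'
    (((measurable_deriv V).sub_const _).mul hcont.measurable).aestronglyMeasurable
    (ae_of_all _ fun x => ?_)
  have hpos := Real.exp_pos (-V x)
  rw [norm_mul, Real.norm_eq_abs, Real.norm_eq_abs, Real.abs_exp, Pi.add_apply, ← add_mul]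
  refine mul_le_mul_of_nonneg_right ?_ hpos.le
  have a1 : deriv V 0 ≤ deriv V 1 := hmd zero_le_one
  have a2 : deriv V (-1) ≤ deriv V 0 := hmd (by norm_num)
  rcases le_total x (-1) with h | h
  · have := hmd (h.trans (by norm_num : (-1 : ℝ) ≤ 0))
    rw [abs_of_nonpos (by linarith)]; nlinarith
  rcases le_total x 1 with h' | h'
  · have b1 := hmd h
    have b2 := hmd h'
    have b3 : 0 ≤ x * (deriv V x - deriv V 0) := by
      rcases le_total 0 x with h | h
      · exact mul_nonneg h (sub_nonneg.2 (hmd h))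
      · exact mul_nonneg_of_nonpos_of_nonpos h (sub_nonpos.2 (hmd h))
    rw [abs_le]; constructor <;> linarith
  · have := hmd (zero_le_one.trans h')
    rw [abs_of_nonneg (by linarith)]; nlinarith

lemma IsConvexPerturbation.integrable_deriv_mul :
    Integrable fun x => deriv V x * Real.exp (-V x) := by
  refine ((hV.integrable_deriv_sub hA).add
    ((hV.integrable_exp_neg hA).const_mul (deriv V 0))).congr (ae_of_all _ fun x => ?_)
  simp only [Pi.add_apply]; ring

lemma IsConvexPerturbation.integrable_mul_deriv_mul :
    Integrable fun x => x * deriv V x * Real.exp (-V x) := by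
  refine ((hV.integrable_mul_deriv_sub hA).add
    ((hV.integrable_mul_exp_neg hA).const_mul (deriv V 0))).congr (ae_of_all _ fun x => ?_)
  simp only [Pi.add_apply]; ring

lemma IsConvexPerturbation.integral_deriv_mul : ∫ x, deriv V x * Real.exp (-V x) = 0 := by
  have := integral_eq_zero_of_hasDerivAt_of_integrable hV.hasDerivAt_exp_neg
    (hV.integrable_deriv_mul hA).neg (hV.integrable_exp_neg hA)
  rwa [integral_neg, neg_eq_zero] at this

lemma IsConvexPerturbation.integral_mul_deriv_mul :
    ∫ x, x * deriv V x * Real.exp (-V x) = ∫ x, Real.exp (-V x) := by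
  have hu : ∀ x, HasDerivAt (fun x => x * Real.exp (-V x))
      (Real.exp (-V x) - x * deriv V x * Real.exp (-V x)) x := by
    intro x
    have := (hasDerivAt_id x).mul (hV.hasDerivAt_exp_neg x)
    exact this.congr_deriv (by simp; ring)
  have := integral_eq_zero_of_hasDerivAt_of_integrable hu
    ((hV.integrable_exp_neg hA).sub (hV.integrable_mul_deriv_mul hA)) (hV.integrable_mul_exp_neg hA)
  rw [integral_sub (hV.integrable_exp_neg hA) (hV.integrable_mul_deriv_mul hA)] at this
  linarith

lemma IsConvexPerturbation.integral_exp_neg_pos : 0 < ∫ x, Real.exp (-V x) :=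
  integral_exp_pos (hV.integrable_exp_neg hA)

lemma IsConvexPerturbation.integrable_sq_len (c : ℝ) :
    Integrable fun x => (len F x - len F c) ^ 2 * Real.exp (-V x) := by
  have hcont : Continuous fun x => Real.exp (-V x) := hV.differentiable.continuous.neg.rexp
  have hm : Integrable fun x => (x - c) * (deriv V x - deriv V c) * Real.exp (-V x) := by
    have := (((hV.integrable_mul_deriv_mul hA).sub ((hV.integrable_deriv_mul hA).const_mul c)).sub
      ((hV.integrable_mul_exp_neg hA).const_mul (deriv V c))).add
      ((hV.integrable_exp_neg hA).const_mul (c * deriv V c))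
    refine this.congr (ae_of_all _ fun x => ?_)
    simp only [Pi.add_apply, Pi.sub_apply]; ring
  refine hm.mono'
    ((((continuous_len hA).sub continuous_const).pow 2).mul hcont).aestronglyMeasurable
    (ae_of_all _ fun x => ?_)
  rw [Real.norm_of_nonneg (by positivity)]
  exact mul_le_mul_of_nonneg_right (hV.sq_len_sub_le hA x c) (Real.exp_pos _).le

/-- The spectral-gap input: with respect to the density `e^{-V}`, the variance of the intrinsic
length is at most one. The centre is the length of the mean position `c`, for which the terms
`V'(c) (x - c)` integrate to zero, and what is left is an integration by parts. -/
lemma IsConvexPerturbation.exists_integral_sq_len_le :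
    ∃ c : ℝ, ∫ x, (len F x - len F c) ^ 2 * Real.exp (-V x) ≤ ∫ x, Real.exp (-V x) := by
  have hZ := hV.integral_exp_neg_pos hA
  set Z := ∫ x, Real.exp (-V x) with hZdef
  set c := (∫ x, x * Real.exp (-V x)) / Z with hc
  refine ⟨c, ?_⟩
  have h1 := hV.integrable_mul_deriv_mul hA
  have h2 := (hV.integrable_deriv_mul hA).const_mul c
  have h3 := (hV.integrable_mul_exp_neg hA).const_mul (deriv V c)
  have h4 := (hV.integrable_exp_neg hA).const_mul (c * deriv V c)
  have h12 : Integrable fun x =>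
      x * deriv V x * Real.exp (-V x) - c * (deriv V x * Real.exp (-V x)) :=
    h1.sub h2
  have h123 : Integrable fun x =>
      x * deriv V x * Real.exp (-V x) - c * (deriv V x * Real.exp (-V x))
      - deriv V c * (x * Real.exp (-V x)) := h12.sub h3
  calc ∫ x, (len F x - len F c) ^ 2 * Real.exp (-V x)
      ≤ ∫ x, (x * deriv V x * Real.exp (-V x) - c * (deriv V x * Real.exp (-V x))
        - deriv V c * (x * Real.exp (-V x)) + c * deriv V c * Real.exp (-V x)) := by
        refine integral_mono (hV.integrable_sq_len hA c) (h123.add h4) fun x => ?_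
        have := mul_le_mul_of_nonneg_right (hV.sq_len_sub_le hA x c) (Real.exp_pos (-V x)).le
        simp only
        linarith
    _ = Z := by
        rw [integral_add h123 h4, integral_sub h12 h3, integral_sub h1 h2,
          integral_const_mul, integral_const_mul, integral_const_mul,
          hV.integral_mul_deriv_mul hA, hV.integral_deriv_mul hA]
        have : ∫ x, x * Real.exp (-V x) = c * Z := by rw [hc]; field_simp
        rw [this]; ring

end Pert

/-! ### Covariance and comparison estimates for one spin -/

/-- The probability measure on the line with density proportional to `e^{-V}`. -/
def lineGibbs (V : ℝ → ℝ) : Measure ℝ := volume.tilted fun t => -V t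

/-- `f` is Lipschitz with constant `a` for the distance `|len F x - len F y| = |ρ(x, y)|`. -/
def LenLipschitz (F : ℝ → ℝ) (a : ℝ≥0) (f : ℝ → ℝ) : Prop :=
  ∀ x y, |f x - f y| ≤ a * |len F x - len F y|

lemma integral_lineGibbs (V f : ℝ → ℝ) :
    ∫ t, f t ∂lineGibbs V = (∫ t, f t * Real.exp (-V t)) / ∫ t, Real.exp (-V t) := by
  rw [lineGibbs, integral_tilted, ← integral_div]
  congr 1 with t
  rw [smul_eq_mul]; ring

section Lip

variable {F : ℝ → ℝ} (hA : ConditionA F) {a b : ℝ≥0} {f g : ℝ → ℝ}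

include hA in
lemma LenLipschitz.continuous (hf : LenLipschitz F a f) : Continuous f := by
  refine continuous_iff_continuousAt.2 fun y => ?_
  have h : Tendsto (fun x => (a : ℝ) * |len F x - len F y|) (𝓝 y) (𝓝 0) := by
    have : Continuous fun x => (a : ℝ) * |len F x - len F y| :=
      continuous_const.mul ((continuous_len hA).sub continuous_const).abs
    simpa using this.tendsto y
  refine tendsto_iff_dist_tendsto_zero.2 (squeeze_zero (fun _ => dist_nonneg) (fun x => ?_) h)
  exact hf x y

variable {V : ℝ → ℝ} (hV : IsConvexPerturbation F V)

include hA hV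

lemma IsConvexPerturbation.isProbabilityMeasure : IsProbabilityMeasure (lineGibbs V) :=
  isProbabilityMeasure_tilted (hV.integrable_exp_neg hA)

lemma LenLipschitz.integrable_sq_mul_exp_neg (hf : LenLipschitz F a f) (c : ℝ) :
    Integrable fun x => (f x - f c) ^ 2 * Real.exp (-V x) := by
  refine ((hV.integrable_sq_len hA c).const_mul (a ^ 2 : ℝ)).mono'
    ((((hf.continuous hA).sub continuous_const).pow 2).mul
      hV.differentiable.continuous.neg.rexp).aestronglyMeasurable (ae_of_all _ fun x => ?_)
  rw [Real.norm_of_nonneg (by positivity), ← mul_assoc, ← mul_pow]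
  refine mul_le_mul_of_nonneg_right ?_ (Real.exp_pos _).le
  refine sq_le_sq.2 ((hf x c).trans_eq ?_)
  rw [abs_mul, NNReal.abs_eq]

lemma LenLipschitz.memLp (hf : LenLipschitz F a f) : MemLp f 2 (lineGibbs V) := by
  have := hV.isProbabilityMeasure hA
  have h : MemLp (fun x => f x - f 0) 2 (lineGibbs V) := by
    have hm : Continuous fun x => f x - f 0 := (hf.continuous hA).sub continuous_const
    rw [memLp_two_iff_integrable_sq hm.aestronglyMeasurable, lineGibbs,
      integrable_tilted_iff (hV.integrable_exp_neg hA)]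
    simpa only [smul_eq_mul, mul_comm] using hf.integrable_sq_mul_exp_neg hA hV 0
  have e : f = (fun x => f x - f 0) + fun _ => f 0 := by ext x; simp
  rw [e]
  exact h.add (memLp_const (f 0))

lemma LenLipschitz.variance_le (hf : LenLipschitz F a f) :
    ProbabilityTheory.variance f (lineGibbs V) ≤ a ^ 2 := by
  have := hV.isProbabilityMeasure hA
  obtain ⟨c, hc⟩ := hV.exists_integral_sq_len_le hA
  have hZ := hV.integral_exp_neg_pos hA
  rw [← ProbabilityTheory.variance_sub_const (hf.continuous hA).aestronglyMeasurable (f c)]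
  refine (ProbabilityTheory.variance_le_expectation_sq
    ((hf.continuous hA).sub continuous_const).aestronglyMeasurable).trans ?_
  change ∫ x, (f x - f c) ^ 2 ∂lineGibbs V ≤ _
  rw [ integral_lineGibbs, div_le_iff₀ hZ]
  calc ∫ x, (f x - f c) ^ 2 * Real.exp (-V x)
      ≤ ∫ x, (a ^ 2 : ℝ) * ((len F x - len F c) ^ 2 * Real.exp (-V x)) := by
        refine integral_mono (hf.integrable_sq_mul_exp_neg hA hV c)
          ((hV.integrable_sq_len hA c).const_mul _) fun x => ?_
        simp only
        rw [← mul_assoc, ← mul_pow]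
        refine mul_le_mul_of_nonneg_right ?_ (Real.exp_pos _).le
        refine sq_le_sq.2 ((hf x c).trans_eq ?_)
        rw [abs_mul, NNReal.abs_eq]
    _ ≤ a ^ 2 * ∫ x, Real.exp (-V x) := by
        rw [integral_const_mul]; gcongr

lemma LenLipschitz.neg_le_covariance (hf : LenLipschitz F a f) (hg : LenLipschitz F b g) :
    -(a * b : ℝ) ≤ ProbabilityTheory.covariance f g (lineGibbs V) := by
  have := hV.isProbabilityMeasure hA
  rcases eq_or_ne a 0 with rfl | ha
  · have : f = fun _ => f 0 := funext fun x => by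
      have := hf x 0; simpa [sub_eq_zero] using this
    rw [this, ProbabilityTheory.covariance_const_left]; simp
  rcases eq_or_ne b 0 with rfl | hb
  · have : g = fun _ => g 0 := funext fun x => by
      have := hg x 0; simpa [sub_eq_zero] using this
    rw [this, ProbabilityTheory.covariance_const_right]; simp
  have hf2 := hf.memLp hA hV
  have hg2 := hg.memLp hA hV
  have h0 := ProbabilityTheory.variance_nonneg ((b : ℝ) • f + (a : ℝ) • g) (lineGibbs V)
  rw [ProbabilityTheory.variance_add (hf2.const_smul _) (hg2.const_smul _),
    ProbabilityTheory.variance_smul, ProbabilityTheory.variance_smul,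
    ProbabilityTheory.covariance_smul_left, ProbabilityTheory.covariance_smul_right] at h0
  have h1 := hf.variance_le hA hV
  have h2 := hg.variance_le hA hV
  have ha' : (0 : ℝ) < a := NNReal.coe_pos.2 (pos_iff_ne_zero.2 ha)
  have hb' : (0 : ℝ) < b := NNReal.coe_pos.2 (pos_iff_ne_zero.2 hb)
  have h3 : 0 ≤ (2 * (a * b) : ℝ) * (a * b + ProbabilityTheory.covariance f g (lineGibbs V)) := by
    nlinarith [mul_le_mul_of_nonneg_left h1 (sq_nonneg (b : ℝ)),
      mul_le_mul_of_nonneg_left h2 (sq_nonneg (a : ℝ))]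
  have := nonneg_of_mul_nonneg_right h3 (by positivity)
  linarith

/-- The covariance estimate for one spin. -/
lemma LenLipschitz.abs_covariance_le (hf : LenLipschitz F a f) (hg : LenLipschitz F b g) :
    |ProbabilityTheory.covariance f g (lineGibbs V)| ≤ a * b := by
  have hg' : LenLipschitz F b (-g) := fun x y => by
    have := hg y x
    rw [abs_sub_comm (len F y)] at this
    convert this using 2; simp; ring
  have h1 := hf.neg_le_covariance hA hV hg
  have h2 := hf.neg_le_covariance hA hV hg'
  rw [ProbabilityTheory.covariance_neg_right] at h2
  exact abs_le.2 ⟨h1, by linarith⟩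

/-- Two convex perturbations of `F` whose difference is `b`-Lipschitz for the intrinsic length
have expectations differing by at most `a b` on `a`-Lipschitz functions: along the linear
interpolation of the potentials the derivative of the expectation is minus a covariance. -/
lemma LenLipschitz.abs_integral_sub_le {W : ℝ → ℝ} (hW : IsConvexPerturbation F W)
    (hf : LenLipschitz F a f) {M : ℝ} (hM : ∀ x, |f x| ≤ M)
    (hd : LenLipschitz F b fun x => W x - V x) :
    |∫ x, f x ∂lineGibbs W - ∫ x, f x ∂lineGibbs V| ≤ a * b := by
  set h : ℝ → ℝ := fun x => W x - V x with hh
  have hfc := hf.continuous hA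
  have hVc := hV.differentiable.continuous
  have hhc := hd.continuous hA
  set P : ℝ → ℝ → ℝ := fun s x => V x + s * h x with hP
  have hPs : ∀ s ∈ Icc (0 : ℝ) 1, IsConvexPerturbation F (P s) := by
    intro s hs
    have hder : ∀ x, HasDerivAt (P s) (deriv V x + s * (deriv W x - deriv V x)) x := fun x =>
      (hV.differentiable x).hasDerivAt.add
        (((hW.differentiable x).hasDerivAt.sub (hV.differentiable x).hasDerivAt).const_mul s)
    refine ⟨fun x => (hder x).differentiableAt, fun x y hxy => ?_⟩
    have e1 := hV.monotone hxy
    have e2 := hW.monotone hxy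
    simp only [(hder _).deriv] at e1 e2 ⊢
    nlinarith [mul_le_mul_of_nonneg_left e1 (sub_nonneg.2 hs.2),
      mul_le_mul_of_nonneg_left e2 hs.1]
  have hPc : ∀ s, Continuous (P s) := fun s => hVc.add (continuous_const.mul hhc)
  -- a bound for the densities, uniform along the interpolation
  set B : ℝ → ℝ := fun x => Real.exp (-V x) + Real.exp (-W x) with hB
  have hBle : ∀ s ∈ Icc (0 : ℝ) 1, ∀ x, Real.exp (-P s x) ≤ B x := by
    intro s hs x
    have : min (V x) (W x) ≤ P s x := by
      simp only [hP, hh]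
      rcases le_total (V x) (W x) with h | h
      · rw [min_eq_left h]; nlinarith [hs.1]
      · rw [min_eq_right h]; nlinarith [hs.2]
    refine (Real.exp_le_exp.2 (neg_le_neg this)).trans ?_
    rcases min_choice (V x) (W x) with e | e <;> rw [e] <;>
      simp only [hB] <;> linarith [Real.exp_pos (-V x), Real.exp_pos (-W x)]
  have hBi : Integrable B := (hV.integrable_exp_neg hA).add (hW.integrable_exp_neg hA)
  have hint : ∀ {U : ℝ → ℝ}, IsConvexPerturbation F U →
      Integrable fun x => |h x| * Real.exp (-U x) := by
    intro U hU
    have := hU.isProbabilityMeasure hA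
    have := ((hd.memLp hA hU).integrable one_le_two).norm
    rw [lineGibbs, integrable_tilted_iff (hU.integrable_exp_neg hA)] at this
    simpa only [smul_eq_mul, mul_comm, Real.norm_eq_abs] using this
  have hhBi : Integrable fun x => |h x| * B x := by
    simp only [hB, mul_add]
    exact (hint hV).add (hint hW)
  -- both numerator and denominator of the expectation are integrals of this form
  have key : ∀ φ : ℝ → ℝ, Continuous φ → (∃ K, 0 ≤ K ∧ ∀ x, |φ x| ≤ K) →
      ContinuousOn (fun s => ∫ x, φ x * Real.exp (-P s x)) (Icc 0 1) ∧
      ∀ s ∈ Ioo (0 : ℝ) 1, HasDerivAt (fun s => ∫ x, φ x * Real.exp (-P s x))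
        (-∫ x, φ x * h x * Real.exp (-P s x)) s := by
    rintro φ hφ ⟨K, hK0, hK⟩
    have hm : ∀ s, AEStronglyMeasurable (fun x => φ x * Real.exp (-P s x)) :=
      fun s => (hφ.mul (hPc s).neg.rexp).aestronglyMeasurable
    have hbd : ∀ s ∈ Icc (0 : ℝ) 1, ∀ x, ‖φ x * Real.exp (-P s x)‖ ≤ K * B x := by
      intro s hs x
      rw [norm_mul, Real.norm_eq_abs, Real.norm_eq_abs, Real.abs_exp]
      exact mul_le_mul (hK x) (hBle s hs x) (Real.exp_pos _).le hK0
    constructor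
    · refine continuousOn_of_dominated (bound := fun x => K * B x) (fun s _ => hm s)
        (fun s hs => ae_of_all _ (hbd s hs)) (hBi.const_mul K) (ae_of_all _ fun x => ?_)
      simp only [hP]
      fun_prop
    · intro s hs
      have := (hasDerivAt_integral_of_dominated_loc_of_deriv_le (μ := volume)
        (F := fun s x => φ x * Real.exp (-P s x))
        (F' := fun s x => -(φ x * h x * Real.exp (-P s x))) (x₀ := s) (s := Ioo 0 1)
        (bound := fun x => K * (|h x| * B x)) (Ioo_mem_nhds hs.1 hs.2)
        (Eventually.of_forall hm)
        ((hBi.const_mul K).mono' (hm s) (ae_of_all _ (hbd s (Ioo_subset_Icc_self hs))))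
        ((hφ.mul hhc).mul (hPc s).neg.rexp).neg.aestronglyMeasurable
        (ae_of_all _ fun x t ht => ?_) (hhBi.const_mul K) (ae_of_all _ fun x t _ => ?_)).2
      · rwa [integral_neg] at this
      · rw [norm_neg, norm_mul, norm_mul, Real.norm_eq_abs, Real.norm_eq_abs, Real.norm_eq_abs,
          Real.abs_exp, mul_assoc]
        refine mul_le_mul (hK x) ?_ (by positivity) hK0
        exact mul_le_mul_of_nonneg_left (hBle t (Ioo_subset_Icc_self ht) x) (abs_nonneg _)
      · have h1 : HasDerivAt (fun s => P s x) (h x) t := by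
          exact (((hasDerivAt_id t).mul_const (h x)).const_add (V x)).congr_deriv (one_mul _)
        exact (h1.neg.exp.const_mul (φ x)).congr_deriv (by simp; ring)
  obtain ⟨hNc, hNd⟩ := key f hfc ⟨M, (abs_nonneg _).trans (hM 0), hM⟩
  obtain ⟨hZc, hZd⟩ := key (fun _ => 1) continuous_const ⟨1, zero_le_one, fun _ => by simp⟩
  simp only [one_mul] at hZc hZd
  have hZpos : ∀ s ∈ Icc (0 : ℝ) 1, 0 < ∫ x, Real.exp (-P s x) :=
    fun s hs => (hPs s hs).integral_exp_neg_pos hA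
  obtain ⟨s, hs, e⟩ := exists_hasDerivAt_eq_slope
    (fun s => (∫ x, f x * Real.exp (-P s x)) / ∫ x, Real.exp (-P s x)) _ one_pos
    (hNc.div hZc fun s hs => (hZpos s hs).ne')
    fun s hs => (hNd s hs).div (hZd s hs) (hZpos s (Ioo_subset_Icc_self hs)).ne'
  have hs' := Ioo_subset_Icc_self hs
  have hZs := hZpos s hs'
  have := (hPs s hs').isProbabilityMeasure hA
  have hcov := hf.abs_covariance_le hA (hPs s hs') hd
  rw [ProbabilityTheory.covariance_eq_sub (hf.memLp hA (hPs s hs')) (hd.memLp hA (hPs s hs')),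
    integral_lineGibbs, integral_lineGibbs, integral_lineGibbs] at hcov
  simp only [Pi.mul_apply] at hcov
  have h0 : P 0 = V := by ext x; simp [hP]
  have h1 : P 1 = W := by ext x; simp [hP, hh]
  rw [h0, h1, ← integral_lineGibbs, ← integral_lineGibbs, sub_zero, div_one] at e
  rw [← e, ← abs_neg]
  convert hcov using 2
  field_simp
  ring

end Lip

/-! ### Cylinder functions that are Lipschitz for the intrinsic length -/

/-- Bounded cylinder functions that are Lipschitz with constant `a k` in the `k`-th spin, for the
distance `|ρ|`. These play the role of the functions with `δ_k(f) ≤ a k`; unlike differentiability,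
the condition is visibly inherited by conditional expectations. -/
structure IsLipCyl {d : ℕ} (F : ℝ → ℝ) (a : Site d → ℝ≥0) (f : Config d → ℝ) : Prop where
  cyl : ∃ s : Finset (Site d), DependsOn f (s : Set (Site d))
  bdd : ∃ M : ℝ, ∀ x, |f x| ≤ M
  lip : ∀ k x, LenLipschitz F (a k) fun t => f (Function.update x k t)

section LipCyl

variable {d : ℕ} {F : ℝ → ℝ} {a b : Site d → ℝ≥0} {f g : Config d → ℝ}

lemma IsLipCyl.abs_sub_le (hf : IsLipCyl F a f) {s : Finset (Site d)}
    (hs : DependsOn f (s : Set (Site d))) (x y : Config d) :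
    |f x - f y| ≤ ∑ j ∈ s, a j * |len F (x j) - len F (y j)| := by
  have key : ∀ t : Finset (Site d), |f (t.piecewise x y) - f y|
      ≤ ∑ j ∈ t, a j * |len F (x j) - len F (y j)| := by
    intro t
    induction t using Finset.induction_on with
    | empty => simp
    | insert j t hj ih =>
      rw [Finset.sum_insert hj, Finset.piecewise_insert]
      have h := hf.lip j (t.piecewise x y) (x j) (y j)
      have e : Function.update (t.piecewise x y) j (y j) = t.piecewise x y := by
        rw [Function.update_eq_self_iff, Finset.piecewise_eq_of_notMem _ _ _ hj]
      simp only [e] at h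
      calc _ ≤ _ := _root_.abs_sub_le _ (f (t.piecewise x y)) _
        _ ≤ _ := add_le_add h ih
  have e : f (s.piecewise x y) = f x := hs fun i hi => by
    simp [Finset.piecewise_eq_of_mem _ _ _ (Finset.mem_coe.1 hi)]
  rw [← e]; exact key s

lemma IsLipCyl.continuous (hA : ConditionA F) (hf : IsLipCyl F a f) : Continuous f := by
  obtain ⟨s, hs⟩ := hf.cyl
  refine continuous_iff_continuousAt.2 fun y => ?_
  have h : Tendsto (fun x : Config d => ∑ j ∈ s, (a j : ℝ) * |len F (x j) - len F (y j)|)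
      (𝓝 y) (𝓝 0) := by
    have : Continuous fun x : Config d => ∑ j ∈ s, (a j : ℝ) * |len F (x j) - len F (y j)| :=
      continuous_finsetSum _ fun j _ => continuous_const.mul
        (((continuous_len hA).comp (continuous_apply j)).sub continuous_const).abs
    simpa using this.tendsto y
  exact tendsto_iff_dist_tendsto_zero.2
    (squeeze_zero (fun _ => dist_nonneg) (fun x => hf.abs_sub_le hs x y) h)

lemma IsLipCyl.isCbCyl (hA : ConditionA F) (hf : IsLipCyl F a f) : IsCbCyl f := by
  obtain ⟨s, hs⟩ := hf.cyl
  refine ⟨⟨s, fun z => f (Function.updateFinset 0 s z), ?_, fun x => hs fun i hi => ?_⟩, hf.bdd⟩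
  · refine (hf.continuous hA).comp (continuous_pi fun i => ?_)
    unfold Function.updateFinset
    split_ifs
    · exact continuous_apply _
    · exact continuous_const
  · simp [Function.updateFinset, Finset.mem_coe.1 hi]

lemma IsLipCyl.integrable (hA : ConditionA F) (hf : IsLipCyl F a f) (μ : Measure (Config d))
    [IsFiniteMeasure μ] : Integrable f μ := by
  obtain ⟨M, hM⟩ := hf.bdd
  exact .of_bound (hf.continuous hA).aestronglyMeasurable M (ae_of_all _ hM)

lemma IsLipCyl.memLp (hA : ConditionA F) (hf : IsLipCyl F a f) (μ : Measure (Config d))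
    [IsFiniteMeasure μ] : MemLp f 2 μ := by
  obtain ⟨M, hM⟩ := hf.bdd
  exact .of_bound (hf.continuous hA).aestronglyMeasurable M (ae_of_all _ hM)

lemma IsLipCyl.mul (hf : IsLipCyl F a f) (hg : IsLipCyl F b g) :
    ∃ c : Site d → ℝ≥0, IsLipCyl F c fun x => f x * g x := by
  obtain ⟨s, hs⟩ := hf.cyl
  obtain ⟨t, ht⟩ := hg.cyl
  obtain ⟨M, hM⟩ := hf.bdd
  obtain ⟨N, hN⟩ := hg.bdd
  have hM0 : 0 ≤ M := (abs_nonneg _).trans (hM 0)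
  have hN0 : 0 ≤ N := (abs_nonneg _).trans (hN 0)
  refine ⟨fun k => a k * N.toNNReal + M.toNNReal * b k, ⟨s ∪ t, fun x y h => ?_⟩,
    ⟨M * N, fun x => ?_⟩,
    fun k x u v => ?_⟩
  · have e1 : f x = f y := hs fun i hi => h i (by simp [Finset.mem_coe.1 hi])
    have e2 : g x = g y := ht fun i hi => h i (by simp [Finset.mem_coe.1 hi])
    simp only [e1, e2]
  · rw [abs_mul]; exact mul_le_mul (hM x) (hN x) (abs_nonneg _) hM0
  · have h1 := hf.lip k x u v
    have h2 := hg.lip k x u v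
    simp only at h1 h2 ⊢
    set fu := f (Function.update x k u)
    set fv := f (Function.update x k v)
    set gu := g (Function.update x k u)
    set gv := g (Function.update x k v)
    have e : fu * gu - fv * gv = (fu - fv) * gu + fv * (gu - gv) := by ring
    rw [e]
    push_cast
    rw [Real.coe_toNNReal _ hM0, Real.coe_toNNReal _ hN0]
    calc _ ≤ |fu - fv| * |gu| + |fv| * |gu - gv| := by
          rw [← abs_mul, ← abs_mul]; exact abs_add_le _ _
      _ ≤ (a k * |len F u - len F v|) * N + M * (b k * |len F u - len F v|) := by
          gcongr
          · exact hN _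
          · exact hM _
      _ = _ := by ring

lemma IsLipCyl.average {ι : Type*} {s : Finset ι} {f : ι → Config d → ℝ} {a : ι → Site d → ℝ≥0}
    (hf : ∀ i ∈ s, IsLipCyl F (a i) (f i)) (r : ℝ≥0) :
    IsLipCyl F (fun j => r * ∑ i ∈ s, a i j) fun x => r * ∑ i ∈ s, f i x := by
  classical
  have h1 : ∀ i : s, ∃ t : Finset (Site d), DependsOn (f i) (t : Set (Site d)) :=
    fun i => (hf i i.2).cyl
  have h2 : ∀ i : s, ∃ M : ℝ, ∀ x, |f i x| ≤ M := fun i => (hf i i.2).bdd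
  choose t ht using h1
  choose M hM using h2
  refine ⟨⟨s.attach.biUnion t, fun x y h => ?_⟩, ⟨r * ∑ i : s, M i, fun x => ?_⟩, fun k x u v => ?_⟩
  · simp only
    congr 1
    refine Finset.sum_congr rfl fun i hi => ht ⟨i, hi⟩ fun j hj => h j ?_
    simp only [Finset.coe_biUnion, mem_iUnion]
    exact ⟨⟨i, hi⟩, by simp, hj⟩
  · rw [abs_mul, NNReal.abs_eq, ← Finset.sum_coe_sort]
    gcongr
    exact (Finset.abs_sum_le_sum_abs _ _).trans (Finset.sum_le_sum fun i _ => hM i x)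
  · simp only
    rw [← mul_sub, abs_mul, NNReal.abs_eq, ← Finset.sum_sub_distrib]
    push_cast
    rw [mul_assoc, Finset.sum_mul]
    gcongr
    exact (Finset.abs_sum_le_sum_abs _ _).trans
      (Finset.sum_le_sum fun i hi => (hf i hi).lip k x u v)

end LipCyl

/-! ### Conditional expectations at one site -/

/-- The potential of the spin at `k` given the other spins, for an interaction whose nonzero terms
have indices in `R`. -/
def siteEnergy {d : ℕ} (F : ℝ → ℝ) (G : Site d → ℝ → ℝ) (lam : ℝ) (R : Finset (Site d))
    (k : Site d) (y : Config d) (t : ℝ) : ℝ :=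
  F t + lam * ∑ i ∈ R, G i (t - y (k - i))

/-- The conditional expectation of `f` given all spins except the one at `k`. -/
def siteMean {d : ℕ} (F : ℝ → ℝ) (G : Site d → ℝ → ℝ) (lam : ℝ) (R : Finset (Site d))
    (k : Site d) (f : Config d → ℝ) (y : Config d) : ℝ :=
  ∫ t, f (Function.update y k t) ∂lineGibbs (siteEnergy F G lam R k y)

/-- The standing assumptions: the interaction is convex, carried by the finite set `R` of
displacements, and dominated by the self-action with coefficients `κ` (which include the
coupling parameter `lam`). -/
structure IsDominated {d : ℕ} (F : ℝ → ℝ) (G : Site d → ℝ → ℝ) (lam : ℝ) (R : Finset (Site d))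
    (κ : Site d → ℝ≥0) : Prop where
  condA : ConditionA F
  lam_nonneg : 0 ≤ lam
  zero_notMem : 0 ∉ R
  range : ∀ j, j ≠ 0 → j ∉ R → ∀ x, G j x = 0
  contDiff : ∀ j ∈ R, ContDiff ℝ 2 (G j)
  convex : ∀ j ∈ R, ∀ x, 0 ≤ second (G j) x
  zero : κ 0 = 0
  bound : ∀ j ∈ R, ∀ x y,
    lam * |second (G j) (x - y)| ≤ κ j * (√(second F x) * √(second F y))

section SiteMean

variable {d : ℕ} {F : ℝ → ℝ} {G : Site d → ℝ → ℝ} {lam : ℝ} {R : Finset (Site d)}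
  {κ : Site d → ℝ≥0} (H : IsDominated F G lam R κ) {a b : Site d → ℝ≥0} {f g : Config d → ℝ}

include H

lemma IsDominated.isConvexPerturbation (k : Site d) (y : Config d) :
    IsConvexPerturbation F (siteEnergy F G lam R k y) := by
  have hder : ∀ t, HasDerivAt (siteEnergy F G lam R k y)
      (deriv F t + lam * ∑ i ∈ R, deriv (G i) (t - y (k - i))) t := by
    intro t
    refine (H.condA.hasDerivAt t).add (HasDerivAt.const_mul lam (HasDerivAt.fun_sum fun i hi => ?_))
    have h1 : HasDerivAt (G i) (deriv (G i) (t - y (k - i))) (t - y (k - i)) :=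
      ((H.contDiff i hi).differentiable (by norm_num) _).hasDerivAt
    exact h1.comp_sub_const t _
  refine ⟨fun t => (hder t).differentiableAt, fun u v huv => ?_⟩
  simp only [(hder _).deriv, add_sub_cancel_left]
  refine mul_le_mul_of_nonneg_left (Finset.sum_le_sum fun i hi => ?_) H.lam_nonneg
  exact monotone_of_hasDerivAt_nonneg (hasDerivAt_deriv_second (H.contDiff i hi))
    (H.convex i hi) (by linarith)

lemma IsDominated.siteEnergy_update_self (k : Site d) (y : Config d) (u : ℝ) :
    siteEnergy F G lam R k (Function.update y k u) = siteEnergy F G lam R k y := by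
  ext t
  unfold siteEnergy
  congr 2
  refine Finset.sum_congr rfl fun i hi => ?_
  have : k - i ≠ k := fun h => H.zero_notMem (by rwa [sub_eq_self.1 h] at hi)
  rw [Function.update_of_ne this]

/-- Moving the spin at `j` changes the potential at `k` by a function that is Lipschitz for the
intrinsic length, with a constant proportional to the intrinsic displacement. -/
lemma IsDominated.lenLipschitz_siteEnergy_sub (k j : Site d) (y : Config d) (u v : ℝ) :
    LenLipschitz F (κ (k - j) * Real.nnabs (len F u - len F v)) fun t =>
      siteEnergy F G lam R k (Function.update y j u) t
        - siteEnergy F G lam R k (Function.update y j v) t := by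
  by_cases hj : k - j ∈ R
  · have e : ∀ t, siteEnergy F G lam R k (Function.update y j u) t
        - siteEnergy F G lam R k (Function.update y j v) t
        = lam * (G (k - j) (t - u) - G (k - j) (t - v)) := by
      intro t
      unfold siteEnergy
      rw [add_sub_add_left_eq_sub, ← mul_sub, ← Finset.sum_sub_distrib,
        Finset.sum_eq_single_of_mem _ hj]
      · simp
      · intro i _ hi
        have : k - i ≠ j := fun h => hi (by rw [← h]; abel)
        simp [Function.update_of_ne this]
    simp only [LenLipschitz, e]
    have h2 := H.contDiff _ hj
    refine abs_sub_le_len_of_hasDerivAt H.condA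
      (φ' := fun t => lam * (deriv (G (k - j)) (t - u) - deriv (G (k - j)) (t - v))) (fun t => ?_)
      fun t => ?_
    · have h1 : ∀ w, HasDerivAt (fun t => G (k - j) (t - w)) (deriv (G (k - j)) (t - w)) t :=
        fun w => (h2.differentiable (by norm_num) (t - w)).hasDerivAt.comp_sub_const t w
      exact ((h1 u).sub (h1 v)).const_mul lam
    · have h3 := abs_sub_le_len_of_hasDerivAt H.condA
        (φ := fun s => lam * deriv (G (k - j)) (t - s))
        (φ' := fun s => lam * -second (G (k - j)) (t - s)) (A := κ (k - j) * √(second F t))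
        (fun s => ((hasDerivAt_deriv_second h2 (t - s)).comp_const_sub t s).const_mul lam)
        (fun s => ?_) u v
      · rw [mul_sub]
        refine h3.trans_eq ?_
        push_cast
        ring
      · rw [abs_mul, abs_neg, abs_of_nonneg H.lam_nonneg]
        exact (H.bound _ hj t s).trans_eq (mul_assoc _ _ _).symm
  · have e : ∀ w, siteEnergy F G lam R k (Function.update y j w) = siteEnergy F G lam R k y := by
      intro w
      ext t
      unfold siteEnergy
      congr 2
      refine Finset.sum_congr rfl fun i hi => ?_
      have : k - i ≠ j := fun h => hj (by rw [← h]; convert hi using 1; abel)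
      rw [Function.update_of_ne this]
    intro s t
    simp only [e, sub_self, abs_zero]
    positivity

lemma IsDominated.siteMean_update_self (k : Site d) (y : Config d) (u : ℝ) :
    siteMean F G lam R k f (Function.update y k u) = siteMean F G lam R k f y := by
  simp only [siteMean, H.siteEnergy_update_self, Function.update_idem]

/-- The effect of a conditional expectation on Lipschitz constants. -/
lemma IsDominated.isLipCyl_siteMean (hf : IsLipCyl F a f) (k : Site d) :
    IsLipCyl F (fun j => if j = k then 0 else a j + κ (k - j) * a k) (siteMean F G lam R k f) := by
  classical
  have hA := H.condA
  have hprob : ∀ y, IsProbabilityMeasure (lineGibbs (siteEnergy F G lam R k y)) :=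
    fun y => (H.isConvexPerturbation k y).isProbabilityMeasure hA
  obtain ⟨s, hs⟩ := hf.cyl
  obtain ⟨M, hM⟩ := hf.bdd
  refine ⟨⟨s ∪ R.image fun i => k - i, fun x y h => ?_⟩, ⟨M, fun y => ?_⟩, fun j y u v => ?_⟩
  · have e1 : siteEnergy F G lam R k x = siteEnergy F G lam R k y := by
      ext t
      unfold siteEnergy
      congr 2
      refine Finset.sum_congr rfl fun i hi => ?_
      rw [h (k - i) (by simp only [Finset.coe_union, Finset.coe_image]; exact Or.inr ⟨i, hi, rfl⟩)]
    have e2 : ∀ t, f (Function.update x k t) = f (Function.update y k t) := fun t =>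
      hs fun i hi => by
        by_cases hik : i = k
        · subst hik; simp
        · simp only [Function.update_of_ne hik]
          exact h i (by simp [Finset.mem_coe.1 hi])
    simp only [siteMean, e1, e2]
  · have := hprob y
    have := norm_integral_le_of_norm_le_const (μ := lineGibbs (siteEnergy F G lam R k y))
      (f := fun t => f (Function.update y k t)) (C := M) (ae_of_all _ fun t => hM _)
    simpa [siteMean] using this
  · by_cases hjk : j = k
    · subst hjk
      simp [H.siteMean_update_self]
    simp only [if_neg hjk]
    have hpv := hprob (Function.update y j v)
    have hpu := hprob (Function.update y j u)
    set νu := lineGibbs (siteEnergy F G lam R k (Function.update y j u)) with hνu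
    set νv := lineGibbs (siteEnergy F G lam R k (Function.update y j v)) with hνv
    have hlu := hf.lip k (Function.update y j u)
    have hlv := hf.lip k (Function.update y j v)
    have hiu : Integrable (fun t => f (Function.update (Function.update y j u) k t)) νv :=
      .of_bound (hlu.continuous hA).aestronglyMeasurable M (ae_of_all _ fun _ => hM _)
    have hiv : Integrable (fun t => f (Function.update (Function.update y j v) k t)) νv :=
      .of_bound (hlv.continuous hA).aestronglyMeasurable M (ae_of_all _ fun _ => hM _)
    have h1 : |∫ t, f (Function.update (Function.update y j u) k t) ∂νu
        - ∫ t, f (Function.update (Function.update y j u) k t) ∂νv|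
        ≤ a k * (κ (k - j) * Real.nnabs (len F u - len F v) : ℝ≥0) :=
      hlu.abs_integral_sub_le hA (H.isConvexPerturbation k _) (H.isConvexPerturbation k _)
        (fun _ => hM _) (H.lenLipschitz_siteEnergy_sub k j y u v)
    have h2 : |∫ t, f (Function.update (Function.update y j u) k t) ∂νv
        - ∫ t, f (Function.update (Function.update y j v) k t) ∂νv|
        ≤ a j * |len F u - len F v| := by
      rw [← integral_sub hiu hiv]
      have := norm_integral_le_of_norm_le_const (μ := νv)
        (f := fun t => f (Function.update (Function.update y j u) k t)
          - f (Function.update (Function.update y j v) k t)) (C := a j * |len F u - len F v|)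
        (ae_of_all _ fun t => ?_)
      · simpa using this
      · rw [Function.update_comm hjk, Function.update_comm hjk]
        exact hf.lip j _ u v
    have h3 := (abs_sub_le _ _ _).trans (add_le_add h1 h2)
    refine h3.trans_eq ?_
    push_cast
    ring

lemma IsDominated.siteMean_mul_siteMean (k : Site d) (y : Config d) :
    siteMean F G lam R k (fun x => f x * siteMean F G lam R k g x) y
      = siteMean F G lam R k f y * siteMean F G lam R k g y := by
  conv_lhs => rw [siteMean]
  simp only [H.siteMean_update_self]
  rw [integral_mul_const]; rfl

/-- The conditional covariance at one site. -/
lemma IsDominated.abs_siteMean_mul_sub_le (hf : IsLipCyl F a f) (hg : IsLipCyl F b g)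
    (k : Site d) (y : Config d) :
    |siteMean F G lam R k (fun x => f x * g x) y
      - siteMean F G lam R k f y * siteMean F G lam R k g y| ≤ a k * b k := by
  have hV := H.isConvexPerturbation k y
  have := hV.isProbabilityMeasure H.condA
  have h1 := (hf.lip k y).abs_covariance_le H.condA hV (hg.lip k y)
  rwa [ProbabilityTheory.covariance_eq_sub ((hf.lip k y).memLp H.condA hV)
    ((hg.lip k y).memLp H.condA hV)] at h1

/-- The finite-volume expectation for a single site is the conditional expectation `siteMean`. -/
lemma IsDominated.localExpectation_singleton (k : Site d) (y : Config d) :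
    localExpectation F G lam {k} f y = siteMean F G lam R k f y := by
  have hE : ∀ x : Config d, interactionEnergy G {k} x = ∑ i ∈ R, G i (x k - x (k - i)) := by
    intro x
    have e0 : (Finset.erase {k} k : Finset (Site d)) = ∅ := by simp
    have h0 : ∀ i ∈ R, k - i ∉ ({k} : Finset (Site d)) := fun i hi h => by
      rw [Finset.mem_singleton, sub_eq_self] at h
      exact H.zero_notMem (h ▸ hi)
    let e : R ↪ {j : Site d // j ∉ ({k} : Finset (Site d))} :=
      ⟨fun i => ⟨k - i.1, h0 i.1 i.2⟩, fun i j h =>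
        Subtype.ext (by simpa using congrArg Subtype.val h)⟩
    unfold interactionEnergy
    rw [Finset.sum_singleton, Finset.sum_singleton, e0, Finset.sum_empty, mul_zero, add_zero,
      tsum_eq_sum (s := R.attach.map e)]
    · rw [Finset.sum_map, ← Finset.sum_attach R]
      refine Finset.sum_congr rfl fun i _ => ?_
      change G (k - (k - i.1)) (x k - x (k - i.1)) = _
      rw [sub_sub_cancel]
    · rintro ⟨j, hj⟩ hjR
      refine H.range _ (fun h => hj (by rw [sub_eq_zero.1 h]; simp)) (fun h => hjR ?_) _
      rw [Finset.mem_map]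
      exact ⟨⟨k - j, h⟩, Finset.mem_attach _ _, Subtype.ext (sub_sub_cancel k j)⟩
  have hD : ∀ t, gibbsDensity F G lam {k} (Function.update y k t)
      = Real.exp (-siteEnergy F G lam R k y t) := by
    intro t
    have : ∑ i ∈ R, G i (Function.update y k t k - Function.update y k t (k - i))
        = ∑ i ∈ R, G i (t - y (k - i)) := by
      refine Finset.sum_congr rfl fun i hi => ?_
      have : k - i ≠ k := fun h => H.zero_notMem (by rwa [sub_eq_self.1 h] at hi)
      rw [Function.update_of_ne this, Function.update_self]
    rw [gibbsDensity, hE, this, Finset.prod_singleton, Function.update_self, ← Real.exp_add,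
      siteEnergy]
    congr 1; ring
  have hI : ∀ φ : ℝ → ℝ, ∫ z : ({k} : Finset (Site d)) → ℝ, φ (z default) = ∫ t, φ t := fun φ =>
    (volume_preserving_funUnique ({k} : Finset (Site d)) ℝ).integral_comp' φ
  have hU : ∀ z : ({k} : Finset (Site d)) → ℝ,
      Function.updateFinset y {k} z = Function.update y k (z default) := fun z =>
    Function.updateFinset_singleton
  rw [siteMean, integral_lineGibbs]
  simp only [localExpectation, hU, hD]
  rw [hI fun t => f (Function.update y k t) * Real.exp (-siteEnergy F G lam R k y t),
    hI fun t => Real.exp (-siteEnergy F G lam R k y t)]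

end SiteMean

/-! ### Iterated Lipschitz constants and the Dobrushin series -/

section Iteration

variable {d : ℕ} (κ : Site d → ℝ≥0)

/-- The Lipschitz constants obtained from `a` by averaging the conditional expectations at the
sites of `Λ`. -/
def averagedLip (Λ : Finset (Site d)) (a : Site d → ℝ≥0) (j : Site d) : ℝ≥0 :=
  (Λ.card : ℝ≥0)⁻¹ * ∑ k ∈ Λ, if j = k then 0 else a j + κ (k - j) * a k

/-- The accumulated constants of the first `n` averaging steps, divided by the number of sites. -/
def accumulatedLip (Λ : Finset (Site d)) (a : Site d → ℝ≥0) (n : ℕ) (j : Site d) : ℝ≥0 :=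
  (Λ.card : ℝ≥0)⁻¹ * ∑ m ∈ Finset.range n, (averagedLip κ Λ)^[m] a j

/-- The transpose of the interdependence matrix `(κ (k - j))_{k, j}`. -/
def interdependence (v : Site d → ℝ≥0∞) (j : Site d) : ℝ≥0∞ := ∑' k, κ (k - j) * v k

/-- The Neumann series of the interdependence matrix, applied to `a`. -/
def dobrushinSeries (a : Site d → ℝ≥0) (j : Site d) : ℝ≥0∞ :=
  ∑' m : ℕ, (interdependence κ)^[m] (fun i => (a i : ℝ≥0∞)) j

variable {κ}

lemma interdependence_tsum (v : ℕ → Site d → ℝ≥0∞) (j : Site d) :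
    interdependence κ (fun i => ∑' m, v m i) j = ∑' m, interdependence κ (v m) j := by
  simp only [interdependence, ← ENNReal.tsum_mul_left]
  exact ENNReal.tsum_comm

lemma dobrushinSeries_eq (a : Site d → ℝ≥0) (j : Site d) :
    dobrushinSeries κ a j = a j + interdependence κ (dobrushinSeries κ a) j := by
  change _ = _ + interdependence κ (fun i => ∑' m : ℕ, (interdependence κ)^[m] _ i) j
  rw [interdependence_tsum, dobrushinSeries, tsum_eq_zero_add' ENNReal.summable]
  simp only [Function.iterate_zero, id_eq, Function.iterate_succ_apply']

variable (hκ : κ 0 = 0) {Λ : Finset (Site d)} (hΛ : Λ.Nonempty)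
include hκ hΛ

lemma averagedLip_add (a : Site d → ℝ≥0) (j : Site d) :
    averagedLip κ Λ a j + (if j ∈ Λ then (Λ.card : ℝ≥0)⁻¹ * a j else 0)
      = a j + (Λ.card : ℝ≥0)⁻¹ * ∑ k ∈ Λ, κ (k - j) * a k := by
  have hN : (Λ.card : ℝ≥0) ≠ 0 := by simpa using hΛ.ne_empty
  have h1 : (if j ∈ Λ then (Λ.card : ℝ≥0)⁻¹ * a j else 0)
      = (Λ.card : ℝ≥0)⁻¹ * ∑ k ∈ Λ, if j = k then a k else 0 := by
    rw [Finset.sum_ite_eq, mul_ite, mul_zero]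
  rw [h1, averagedLip, ← mul_add, ← Finset.sum_add_distrib]
  have h2 : ∀ k ∈ Λ, (if j = k then 0 else a j + κ (k - j) * a k) + (if j = k then a k else 0)
      = a j + κ (k - j) * a k := by
    intro k _
    split_ifs with h
    · subst h; simp [hκ]
    · simp
  rw [Finset.sum_congr rfl h2, Finset.sum_add_distrib, mul_add, Finset.sum_const, nsmul_eq_mul,
    inv_mul_cancel_left₀ hN]

lemma iterate_averagedLip_add (a : Site d → ℝ≥0) (n : ℕ) (j : Site d) :
    (averagedLip κ Λ)^[n] a j + (if j ∈ Λ then accumulatedLip κ Λ a n j else 0)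
      = a j + ∑ k ∈ Λ, κ (k - j) * accumulatedLip κ Λ a n k := by
  induction n with
  | zero => simp [accumulatedLip]
  | succ n ih =>
    have hS : ∀ k, accumulatedLip κ Λ a (n + 1) k
        = accumulatedLip κ Λ a n k + (Λ.card : ℝ≥0)⁻¹ * (averagedLip κ Λ)^[n] a k := by
      intro k
      rw [accumulatedLip, Finset.sum_range_succ, mul_add]; rfl
    have h1 := averagedLip_add hκ hΛ ((averagedLip κ Λ)^[n] a) j
    simp only [hS, mul_add, Finset.sum_add_distrib, Function.iterate_succ_apply']
    rw [← add_assoc, ← ih]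
    have h2 : ∑ k ∈ Λ, κ (k - j) * ((Λ.card : ℝ≥0)⁻¹ * (averagedLip κ Λ)^[n] a k)
        = (Λ.card : ℝ≥0)⁻¹ * ∑ k ∈ Λ, κ (k - j) * (averagedLip κ Λ)^[n] a k := by
      rw [Finset.mul_sum]
      exact Finset.sum_congr rfl fun k _ => by ring
    rw [h2, add_right_comm, ← h1]
    split_ifs <;> ring

lemma accumulatedLip_le (a : Site d → ℝ≥0) (n : ℕ) :
    ∀ j ∈ Λ, (accumulatedLip κ Λ a n j : ℝ≥0∞) ≤ dobrushinSeries κ a j := by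
  have hr : (Λ.card : ℝ≥0)⁻¹ ≤ 1 := inv_le_one_of_one_le₀ (by exact_mod_cast hΛ.card_pos)
  induction n with
  | zero => simp [accumulatedLip]
  | succ n ih =>
    intro j hj
    have h1 := iterate_averagedLip_add hκ hΛ a n j
    rw [if_pos hj] at h1
    have h2 : accumulatedLip κ Λ a (n + 1) j
        ≤ a j + ∑ k ∈ Λ, κ (k - j) * accumulatedLip κ Λ a n k := by
      rw [← h1, accumulatedLip, Finset.sum_range_succ, mul_add, add_comm]
      exact add_le_add (mul_le_of_le_one_left zero_le hr) le_rfl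
    calc (accumulatedLip κ Λ a (n + 1) j : ℝ≥0∞)
        ≤ a j + ∑ k ∈ Λ, κ (k - j) * (accumulatedLip κ Λ a n k : ℝ≥0∞) := by exact_mod_cast h2
      _ ≤ a j + ∑ k ∈ Λ, κ (k - j) * dobrushinSeries κ a k := by
          gcongr with k hk
          exact ih k hk
      _ ≤ a j + interdependence κ (dobrushinSeries κ a) j := by
          gcongr
          exact ENNReal.sum_le_tsum _
      _ = _ := (dobrushinSeries_eq a j).symm

lemma iterate_averagedLip_le (a : Site d → ℝ≥0) (n : ℕ) (j : Site d) :
    ((averagedLip κ Λ)^[n] a j : ℝ≥0∞) ≤ dobrushinSeries κ a j := by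
  have h1 := iterate_averagedLip_add hκ hΛ a n j
  calc ((averagedLip κ Λ)^[n] a j : ℝ≥0∞)
      ≤ a j + ∑ k ∈ Λ, κ (k - j) * (accumulatedLip κ Λ a n k : ℝ≥0∞) := by
        exact_mod_cast le_self_add.trans h1.le
    _ ≤ a j + ∑ k ∈ Λ, κ (k - j) * dobrushinSeries κ a k := by
        gcongr with k hk
        exact accumulatedLip_le hκ hΛ a n k hk
    _ ≤ a j + interdependence κ (dobrushinSeries κ a) j := by
        gcongr
        exact ENNReal.sum_le_tsum _
    _ = _ := (dobrushinSeries_eq a j).symm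

lemma tendsto_iterate_averagedLip {a : Site d → ℝ≥0} {j : Site d} (hj : j ∈ Λ)
    (hU : dobrushinSeries κ a j ≠ ∞) :
    Tendsto (fun n => ((averagedLip κ Λ)^[n] a j : ℝ≥0∞)) atTop (𝓝 0) := by
  have hN : (Λ.card : ℝ≥0) ≠ 0 := by simpa using hΛ.ne_empty
  refine ENNReal.tendsto_atTop_zero_of_tsum_ne_top
    (ne_top_of_le_ne_top (ENNReal.mul_ne_top (ENNReal.natCast_ne_top Λ.card) hU)
      (ENNReal.tsum_le_of_sum_range_le fun n => ?_))
  have h1 : ∑ m ∈ Finset.range n, (averagedLip κ Λ)^[m] a j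
      = Λ.card * accumulatedLip κ Λ a n j := by
    rw [accumulatedLip, mul_inv_cancel_left₀ hN]
  rw [← ENNReal.ofNNReal_finsetSum, h1, ENNReal.coe_mul, ENNReal.coe_natCast]
  gcongr
  exact accumulatedLip_le hκ hΛ a n j hj

omit hΛ in
/-- Averaging over large finite sets makes the total Lipschitz constant arbitrarily small: inside
`Λ` the constants are summable along the iteration, and outside `Λ` they stay below the tail of
the Dobrushin series. -/
lemma exists_tsum_iterate_averagedLip_le {a : Site d → ℝ≥0}
    (ha : ∑' j, dobrushinSeries κ a j ≠ ∞) {ε : ℝ≥0∞} (hε : 0 < ε) :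
    ∃ Λ : Finset (Site d), Λ.Nonempty ∧ ∃ n : ℕ,
      ∑' j, ((averagedLip κ Λ)^[n] a j : ℝ≥0∞) ≤ ε := by
  have hε2 : 0 < ε / 2 := ENNReal.half_pos hε.ne'
  have ht := (ENNReal.tendsto_tsum_compl_atTop_zero ha).eventually (gt_mem_nhds hε2)
  obtain ⟨Λ, hΛt, hΛ0⟩ := (ht.and (eventually_ge_atTop {0})).exists
  have hΛ : Λ.Nonempty := ⟨0, hΛ0 (Finset.mem_singleton_self 0)⟩
  have hlim : Tendsto (fun n => ∑ j ∈ Λ, ((averagedLip κ Λ)^[n] a j : ℝ≥0∞)) atTop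
      (𝓝 (∑ j ∈ Λ, 0)) :=
    tendsto_finsetSum _ fun j hj =>
      tendsto_iterate_averagedLip hκ hΛ hj (ENNReal.ne_top_of_tsum_ne_top ha j)
  rw [Finset.sum_const_zero] at hlim
  obtain ⟨n, hn⟩ := (hlim.eventually (gt_mem_nhds hε2)).exists
  refine ⟨Λ, hΛ, n, ?_⟩
  have hsplit := ENNReal.sum_add_tsum_compl Λ fun j => ((averagedLip κ Λ)^[n] a j : ℝ≥0∞)
  rw [← hsplit]
  refine (add_le_add hn.le (le_trans ?_ hΛt.le)).trans_eq (ENNReal.add_halves ε)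
  exact ENNReal.tsum_le_tsum fun j => iterate_averagedLip_le hκ hΛ a n j

end Iteration

section Weights

variable {d : ℕ} {κ : Site d → ℝ≥0}

lemma tsum_interdependence (v : Site d → ℝ≥0∞) :
    ∑' j, interdependence κ v j = (∑' i, (κ i : ℝ≥0∞)) * ∑' j, v j := by
  simp only [interdependence]
  rw [ENNReal.tsum_comm, ← ENNReal.tsum_mul_left]
  congr 1 with k
  rw [ENNReal.tsum_mul_right]
  congr 1
  exact (Equiv.subLeft k).tsum_eq (fun i => (κ i : ℝ≥0∞))

lemma tsum_dobrushinSeries (a : Site d → ℝ≥0) :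
    ∑' j, dobrushinSeries κ a j = (1 - ∑' i, (κ i : ℝ≥0∞))⁻¹ * ∑' j, (a j : ℝ≥0∞) := by
  have h : ∀ m : ℕ, ∑' j, (interdependence κ)^[m] (fun i => (a i : ℝ≥0∞)) j
      = (∑' i, (κ i : ℝ≥0∞)) ^ m * ∑' j, (a j : ℝ≥0∞) := by
    intro m
    induction m with
    | zero => simp
    | succ m ih => rw [Function.iterate_succ', Function.comp_apply, tsum_interdependence, ih,
        pow_succ', mul_assoc]
  simp only [dobrushinSeries]
  rw [ENNReal.tsum_comm]
  simp only [h]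
  rw [ENNReal.tsum_mul_right, ENNReal.tsum_geometric]

/-- A submultiplicative weight passes through the Dobrushin series, uniformly over a family of
initial constants: it only replaces the coefficients `κ i` by `w i * κ i`. -/
lemma tsum_weight_mul_dobrushinSeries_le {w : Site d → ℝ≥0∞}
    (hw : ∀ i k l, w (i - k) ≤ w (l - i) * w (l - k)) (a : Site d → Site d → ℝ≥0) {B : ℝ≥0∞}
    (ha : ∀ i, ∑' k, w (i - k) * a k i ≤ B) (i : Site d) :
    ∑' k, w (i - k) * dobrushinSeries κ (a k) i ≤ (1 - ∑' i, w i * κ i)⁻¹ * B := by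
  have h : ∀ (m : ℕ) (i : Site d),
      ∑' k, w (i - k) * (interdependence κ)^[m] (fun j => (a k j : ℝ≥0∞)) i
        ≤ (∑' i, w i * κ i) ^ m * B := by
    intro m
    induction m with
    | zero => simpa using ha
    | succ m ih =>
      intro i
      simp only [Function.iterate_succ', Function.comp_apply]
      set v : Site d → Site d → ℝ≥0∞ :=
        fun k => (interdependence κ)^[m] (fun j => (a k j : ℝ≥0∞)) with hv
      calc ∑' k, w (i - k) * interdependence κ (v k) i
          = ∑' k, ∑' l, w (i - k) * (κ (l - i) * v k l) := by
            simp only [interdependence, ENNReal.tsum_mul_left]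
        _ ≤ ∑' k, ∑' l, w (l - i) * κ (l - i) * (w (l - k) * v k l) := by
            refine ENNReal.tsum_le_tsum fun k => ENNReal.tsum_le_tsum fun l => ?_
            calc _ ≤ w (l - i) * w (l - k) * (κ (l - i) * v k l) := by gcongr; exact hw i k l
              _ = _ := by ring
        _ = ∑' l, w (l - i) * κ (l - i) * ∑' k, w (l - k) * v k l := by
            rw [ENNReal.tsum_comm]
            simp only [ENNReal.tsum_mul_left]
        _ ≤ ∑' l, w (l - i) * κ (l - i) * ((∑' i, w i * κ i) ^ m * B) := by
            gcongr with l
            exact ih l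
        _ = _ := by
            rw [ENNReal.tsum_mul_right, pow_succ', mul_assoc]
            congr 1
            exact (Equiv.subRight i).tsum_eq fun j => w j * κ j
  simp only [dobrushinSeries, ← ENNReal.tsum_mul_left]
  rw [ENNReal.tsum_comm, ← ENNReal.tsum_geometric, ← ENNReal.tsum_mul_right]
  exact ENNReal.tsum_le_tsum fun m => h m i

end Weights

/-! ### Covariances and uniqueness of Gibbs measures -/

/-- The average over `k ∈ Λ` of the conditional expectations at `k`. -/
def averagedMean {d : ℕ} (F : ℝ → ℝ) (G : Site d → ℝ → ℝ) (lam : ℝ) (R Λ : Finset (Site d))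
    (f : Config d → ℝ) (x : Config d) : ℝ :=
  ((Λ.card : ℝ≥0)⁻¹ : ℝ≥0) * ∑ k ∈ Λ, siteMean F G lam R k f x

section Gibbs

variable {d : ℕ} {F : ℝ → ℝ} {G : Site d → ℝ → ℝ} {lam : ℝ} {R : Finset (Site d)}
  {κ : Site d → ℝ≥0} (H : IsDominated F G lam R κ) {a b : Site d → ℝ≥0} {f g : Config d → ℝ}
  {μ : Measure (Config d)}

include H

lemma IsDominated.isLipCyl_averagedMean (hf : IsLipCyl F a f) (Λ : Finset (Site d)) :
    IsLipCyl F (averagedLip κ Λ a) (averagedMean F G lam R Λ f) :=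
  IsLipCyl.average (fun k _ => H.isLipCyl_siteMean hf k) _

lemma IsDominated.isLipCyl_iterate (hf : IsLipCyl F a f) (Λ : Finset (Site d)) (n : ℕ) :
    IsLipCyl F ((averagedLip κ Λ)^[n] a) ((averagedMean F G lam R Λ)^[n] f) := by
  induction n with
  | zero => exact hf
  | succ n ih =>
    rw [Function.iterate_succ_apply', Function.iterate_succ_apply']
    exact H.isLipCyl_averagedMean ih Λ

lemma IsDominated.integral_siteMean (hμ : IsGibbs F G lam μ) (hf : IsLipCyl F a f) (k : Site d) :
    ∫ x, siteMean F G lam R k f x ∂μ = ∫ x, f x ∂μ := by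
  rw [← hμ.dlr {k} f (hf.isCbCyl H.condA)]
  simp only [H.localExpectation_singleton]

/-- Replacing `g` by its conditional expectation at `k` changes `μ(fg)` by the average conditional
covariance at `k`. -/
lemma IsDominated.abs_integral_mul_sub_siteMean_le (hμ : IsGibbs F G lam μ) (hf : IsLipCyl F a f)
    (hg : IsLipCyl F b g) (k : Site d) :
    |∫ x, f x * g x ∂μ - ∫ x, f x * siteMean F G lam R k g x ∂μ| ≤ a k * b k := by
  have := hμ.prob
  have hEg := H.isLipCyl_siteMean hg k
  have hEf := H.isLipCyl_siteMean hf k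
  obtain ⟨c, hfg⟩ := hf.mul hg
  obtain ⟨c', hfEg⟩ := hf.mul hEg
  obtain ⟨c'', hEE⟩ := hEf.mul hEg
  rw [← H.integral_siteMean hμ hfg k, ← H.integral_siteMean hμ hfEg k]
  simp only [H.siteMean_mul_siteMean]
  rw [← integral_sub ((H.isLipCyl_siteMean hfg k).integrable H.condA μ)
    (hEE.integrable H.condA μ)]
  have := norm_integral_le_of_norm_le_const (μ := μ)
    (f := fun y => siteMean F G lam R k (fun x => f x * g x) y
      - siteMean F G lam R k f y * siteMean F G lam R k g y) (C := a k * b k)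
    (ae_of_all _ fun y => H.abs_siteMean_mul_sub_le hf hg k y)
  simpa using this

lemma IsDominated.abs_integral_mul_sub_averagedMean_le (hμ : IsGibbs F G lam μ)
    (hf : IsLipCyl F a f) (hg : IsLipCyl F b g) {Λ : Finset (Site d)} (hΛ : Λ.Nonempty) :
    |∫ x, f x * g x ∂μ - ∫ x, f x * averagedMean F G lam R Λ g x ∂μ|
      ≤ ((Λ.card : ℝ≥0)⁻¹ * ∑ k ∈ Λ, a k * b k : ℝ≥0) := by
  have := hμ.prob
  have hN : (Λ.card : ℝ≥0) ≠ 0 := by simpa using hΛ.ne_empty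
  have hN' : (Λ.card : ℝ) ≠ 0 := by simpa using hΛ.ne_empty
  have h1 : ∫ x, f x * averagedMean F G lam R Λ g x ∂μ
      = (Λ.card : ℝ)⁻¹ * ∑ k ∈ Λ, ∫ x, f x * siteMean F G lam R k g x ∂μ := by
    rw [← integral_finsetSum, ← integral_const_mul]
    · congr 1 with x
      simp only [averagedMean, Finset.mul_sum]
      push_cast
      exact Finset.sum_congr rfl fun k _ => by ring
    · intro k _
      obtain ⟨c, hc⟩ := hf.mul (H.isLipCyl_siteMean hg k)
      exact hc.integrable H.condA μ
  have h2 : ∫ x, f x * g x ∂μ = (Λ.card : ℝ)⁻¹ * ∑ k ∈ Λ, ∫ x, f x * g x ∂μ := by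
    rw [Finset.sum_const, nsmul_eq_mul, inv_mul_cancel_left₀ hN']
  rw [h1, h2, ← mul_sub, ← Finset.sum_sub_distrib, abs_mul, abs_of_nonneg (by positivity)]
  push_cast
  gcongr
  exact (Finset.abs_sum_le_sum_abs _ _).trans
    (Finset.sum_le_sum fun k _ => H.abs_integral_mul_sub_siteMean_le hμ hf hg k)

lemma IsDominated.abs_integral_mul_sub_iterate_le (hμ : IsGibbs F G lam μ)
    (hf : IsLipCyl F a f) (hg : IsLipCyl F b g) {Λ : Finset (Site d)} (hΛ : Λ.Nonempty) (n : ℕ) :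
    |∫ x, f x * g x ∂μ - ∫ x, f x * (averagedMean F G lam R Λ)^[n] g x ∂μ|
      ≤ (∑ k ∈ Λ, a k * accumulatedLip κ Λ b n k : ℝ≥0) := by
  induction n with
  | zero =>
    rw [Function.iterate_zero, id, sub_self, abs_zero]
    exact NNReal.coe_nonneg _
  | succ n ih =>
    rw [Function.iterate_succ_apply']
    have h1 := H.abs_integral_mul_sub_averagedMean_le hμ hf (H.isLipCyl_iterate hg Λ n) hΛ
    refine (abs_sub_le _ _ _).trans ((add_le_add ih h1).trans_eq ?_)
    rw [← NNReal.coe_add]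
    congr 1
    rw [Finset.mul_sum, ← Finset.sum_add_distrib]
    refine Finset.sum_congr rfl fun k _ => ?_
    rw [accumulatedLip, accumulatedLip, Finset.sum_range_succ]
    ring

lemma IsDominated.integral_iterate (hμ : IsGibbs F G lam μ) (hg : IsLipCyl F b g)
    {Λ : Finset (Site d)} (hΛ : Λ.Nonempty) (n : ℕ) :
    ∫ x, (averagedMean F G lam R Λ)^[n] g x ∂μ = ∫ x, g x ∂μ := by
  have h1 : IsLipCyl F (fun _ : Site d => 0) fun _ => (1 : ℝ) :=
    ⟨⟨∅, fun _ _ _ => rfl⟩, ⟨1, fun _ => by simp⟩, fun _ _ _ _ => by simp⟩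
  have := H.abs_integral_mul_sub_iterate_le hμ h1 hg hΛ n
  simp only [one_mul, zero_mul, Finset.sum_const_zero, NNReal.coe_zero, abs_nonpos_iff] at this
  exact (sub_eq_zero.1 this).symm

end Gibbs

section Moment

variable {d : ℕ} {F : ℝ → ℝ} {b : Site d → ℝ≥0} {h : Config d → ℝ} {μ : Measure (Config d)}

/-- A function with small total Lipschitz constant is close to a constant in mean. -/
lemma IsLipCyl.lintegral_abs_sub_le (hA : ConditionA F) (hh : IsLipCyl F b h)
    [IsProbabilityMeasure μ] :
    ∫⁻ x, ENNReal.ofReal |h x - h 0| ∂μ ≤ (1 + moment F μ) * ∑' j, (b j : ℝ≥0∞) := by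
  obtain ⟨s, hs⟩ := hh.cyl
  have hc : ∀ j : Site d, Continuous fun x : Config d => |len F (x j)| :=
    fun j => ((continuous_len hA).comp (continuous_apply j)).abs
  calc ∫⁻ x, ENNReal.ofReal |h x - h 0| ∂μ
      ≤ ∫⁻ x, ∑ j ∈ s, (b j : ℝ≥0∞) * ENNReal.ofReal |len F (x j)| ∂μ := by
        refine lintegral_mono fun x => ?_
        refine (ENNReal.ofReal_le_ofReal (hh.abs_sub_le hs x 0)).trans_eq ?_
        rw [ENNReal.ofReal_sum_of_nonneg fun j _ => by positivity]
        refine Finset.sum_congr rfl fun j _ => ?_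
        rw [ENNReal.ofReal_mul (by positivity), ENNReal.ofReal_coe_nnreal, Pi.zero_apply, len_zero,
          sub_zero]
    _ = ∑ j ∈ s, (b j : ℝ≥0∞) * ∫⁻ x, ENNReal.ofReal |len F (x j)| ∂μ := by
        rw [lintegral_finsetSum _ fun j _ =>
          (hc j).measurable.ennreal_ofReal.const_mul _]
        exact Finset.sum_congr rfl fun j _ =>
          lintegral_const_mul _ (hc j).measurable.ennreal_ofReal
    _ ≤ ∑ j ∈ s, (b j : ℝ≥0∞) * (1 + moment F μ) := by
        gcongr with j
        calc ∫⁻ x, ENNReal.ofReal |len F (x j)| ∂μ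
            ≤ ∫⁻ x, (1 + ENNReal.ofReal (rho F (x j) 0 ^ 2)) ∂μ := by
              refine lintegral_mono fun x => ?_
              rw [rho_eq hA, len_zero, zero_sub, neg_sq, ← ENNReal.ofReal_one,
                ← ENNReal.ofReal_add zero_le_one (sq_nonneg _)]
              refine ENNReal.ofReal_le_ofReal ?_
              nlinarith [sq_abs (len F (x j)), sq_nonneg (|len F (x j)| - 1)]
          _ = 1 + ∫⁻ x, ENNReal.ofReal (rho F (x j) 0 ^ 2) ∂μ := by
              rw [lintegral_add_left measurable_const]; simp
          _ ≤ 1 + moment F μ := by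
              gcongr
              exact le_iSup (fun k => ∫⁻ x : Config d, ENNReal.ofReal (rho F (x k) 0 ^ 2) ∂μ) j
    _ ≤ _ := by
        rw [← Finset.sum_mul, mul_comm]
        gcongr
        exact ENNReal.sum_le_tsum s

lemma IsLipCyl.ofReal_abs_integral_sub_le (hA : ConditionA F) (hh : IsLipCyl F b h)
    [IsProbabilityMeasure μ] :
    ENNReal.ofReal |∫ x, h x ∂μ - h 0| ≤ (1 + moment F μ) * ∑' j, (b j : ℝ≥0∞) := by
  refine le_trans ?_ (hh.lintegral_abs_sub_le hA (μ := μ))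
  have h1 : ∫ x, h x ∂μ - h 0 = ∫ x, (h x - h 0) ∂μ := by
    rw [integral_sub (hh.integrable hA μ) (integrable_const _)]; simp
  rw [h1, ← Real.norm_eq_abs, ofReal_norm]
  refine (enorm_integral_le_lintegral_enorm _).trans_eq ?_
  simp only [← ofReal_norm, Real.norm_eq_abs]

lemma IsLipCyl.ofReal_abs_covariance_le (hA : ConditionA F) {a : Site d → ℝ≥0} {f : Config d → ℝ}
    (hf : IsLipCyl F a f) {M : ℝ} (hM : ∀ x, |f x| ≤ M) (hh : IsLipCyl F b h)
    [IsProbabilityMeasure μ] :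
    ENNReal.ofReal |∫ x, f x * h x ∂μ - (∫ x, f x ∂μ) * ∫ x, h x ∂μ|
      ≤ ENNReal.ofReal (2 * M) * ((1 + moment F μ) * ∑' j, (b j : ℝ≥0∞)) := by
  have hM0 : 0 ≤ M := (abs_nonneg _).trans (hM 0)
  obtain ⟨c, hfh⟩ := hf.mul hh
  have hfi := hf.integrable hA μ
  have hhi := hh.integrable hA μ
  set m := ∫ x, f x ∂μ with hm
  have hmM : |m| ≤ M := by
    have := norm_integral_le_of_norm_le_const (μ := μ) (f := f) (C := M) (ae_of_all _ hM)
    simpa using this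
  have h1 : ∫ x, f x * h x ∂μ - m * ∫ x, h x ∂μ = ∫ x, (f x - m) * (h x - h 0) ∂μ := by
    have e : ∀ x, (f x - m) * (h x - h 0) = f x * h x - m * h x - (h 0 * f x - h 0 * m) :=
      fun x => by ring
    simp only [e]
    have i1 := hfh.integrable hA μ
    have i2 := hhi.const_mul m
    have i3 := hfi.const_mul (h 0)
    have i4 := integrable_const (μ := μ) (h 0 * m)
    have i12 : Integrable (fun x => f x * h x - m * h x) μ := i1.sub i2
    have i34 : Integrable (fun x => h 0 * f x - h 0 * m) μ := i3.sub i4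
    rw [integral_sub i12 i34, integral_sub i1 i2, integral_sub i3 i4,
      integral_const_mul, integral_const_mul, integral_const, ← hm]
    simp
  rw [h1, ← Real.norm_eq_abs, ofReal_norm]
  refine (enorm_integral_le_lintegral_enorm _).trans ?_
  calc ∫⁻ x, ‖(f x - m) * (h x - h 0)‖ₑ ∂μ
      ≤ ∫⁻ x, ENNReal.ofReal (2 * M) * ENNReal.ofReal |h x - h 0| ∂μ := by
        refine lintegral_mono fun x => ?_
        rw [← ofReal_norm, ← ENNReal.ofReal_mul (by positivity), norm_mul,
          Real.norm_eq_abs, Real.norm_eq_abs]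
        refine ENNReal.ofReal_le_ofReal (mul_le_mul_of_nonneg_right ?_ (abs_nonneg _))
        exact (abs_sub _ _).trans (by linarith [hM x])
    _ = ENNReal.ofReal (2 * M) * ∫⁻ x, ENNReal.ofReal |h x - h 0| ∂μ :=
        lintegral_const_mul' _ _ ENNReal.ofReal_ne_top
    _ ≤ _ := by
        gcongr
        exact hh.lintegral_abs_sub_le hA

end Moment

section Main

variable {d : ℕ} {F : ℝ → ℝ} {G : Site d → ℝ → ℝ} {lam : ℝ} {R : Finset (Site d)}
  {κ : Site d → ℝ≥0} (H : IsDominated F G lam R κ) {a b : Site d → ℝ≥0} {f g : Config d → ℝ}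
  {μ ν : Measure (Config d)}

include H

/-- The covariance estimate in terms of the Dobrushin series. -/
lemma IsDominated.ofReal_abs_covariance_le (hμ : IsGibbs F G lam μ) (hm : moment F μ < ∞)
    (hf : IsLipCyl F a f) (hg : IsLipCyl F b g) (hb : ∑' j, dobrushinSeries κ b j ≠ ∞) :
    ENNReal.ofReal |ProbabilityTheory.covariance f g μ|
      ≤ ∑' i, (a i : ℝ≥0∞) * dobrushinSeries κ b i := by
  have := hμ.prob
  obtain ⟨M, hM⟩ := hf.bdd
  rw [ProbabilityTheory.covariance_eq_sub (hf.memLp H.condA μ) (hg.memLp H.condA μ)]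
  simp only [Pi.mul_apply]
  set C : ℝ≥0∞ := ENNReal.ofReal (2 * M) * (1 + moment F μ) with hC
  have hCtop : C ≠ ∞ :=
    ENNReal.mul_ne_top ENNReal.ofReal_ne_top (ENNReal.add_ne_top.2 ⟨ENNReal.one_ne_top, hm.ne⟩)
  have key : ∀ ε : ℝ≥0∞, 0 < ε → ENNReal.ofReal |∫ x, f x * g x ∂μ - (∫ x, f x ∂μ) * ∫ x, g x ∂μ|
      ≤ ∑' i, (a i : ℝ≥0∞) * dobrushinSeries κ b i + C * ε := by
    intro ε hε
    obtain ⟨Λ, hΛ, n, hn⟩ := exists_tsum_iterate_averagedLip_le H.zero hb hε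
    have h1 := H.abs_integral_mul_sub_iterate_le hμ hf hg hΛ n
    have hgn := H.isLipCyl_iterate hg Λ n
    have h2 := hf.ofReal_abs_covariance_le (μ := μ) H.condA hM hgn
    rw [H.integral_iterate hμ hg hΛ n] at h2
    refine (ENNReal.ofReal_le_ofReal (abs_sub_le _
      (∫ x, f x * (averagedMean F G lam R Λ)^[n] g x ∂μ) _)).trans ?_
    rw [ENNReal.ofReal_add (abs_nonneg _) (abs_nonneg _)]
    refine add_le_add ((ENNReal.ofReal_le_ofReal h1).trans ?_) (h2.trans ?_)
    · rw [ENNReal.ofReal_coe_nnreal, ENNReal.ofNNReal_finsetSum]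
      refine (Finset.sum_le_sum fun k hk => ?_).trans (ENNReal.sum_le_tsum Λ)
      rw [ENNReal.coe_mul]
      gcongr
      exact accumulatedLip_le H.zero hΛ b n k hk
    · rw [hC, mul_assoc]
      gcongr
  have hlim : Tendsto (fun ε : ℝ≥0∞ => ∑' i, (a i : ℝ≥0∞) * dobrushinSeries κ b i + C * ε)
      (𝓝[>] 0) (𝓝 (∑' i, (a i : ℝ≥0∞) * dobrushinSeries κ b i + C * 0)) :=
    (tendsto_const_nhds.add (ENNReal.Tendsto.const_mul tendsto_id (Or.inr hCtop))).mono_left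
      nhdsWithin_le_nhds
  rw [mul_zero, add_zero] at hlim
  exact ge_of_tendsto hlim (eventually_mem_nhdsWithin.mono fun ε hε => key ε hε)

/-- The averaged conditional expectations of `g` have the same integral as `g` under every Gibbs
measure, and they become constant in mean. -/
lemma IsDominated.integral_eq (hμ : IsGibbs F G lam μ) (hμm : moment F μ < ∞)
    (hν : IsGibbs F G lam ν) (hνm : moment F ν < ∞) (hg : IsLipCyl F b g)
    (hb : ∑' j, dobrushinSeries κ b j ≠ ∞) : ∫ x, g x ∂μ = ∫ x, g x ∂ν := by
  have := hμ.prob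
  have := hν.prob
  set C : ℝ≥0∞ := (1 + moment F μ) + (1 + moment F ν) with hC
  have hCtop : C ≠ ∞ := by simp [hC, hμm.ne, hνm.ne]
  have key : ∀ ε : ℝ≥0∞, 0 < ε → ENNReal.ofReal |∫ x, g x ∂μ - ∫ x, g x ∂ν| ≤ C * ε := by
    intro ε hε
    obtain ⟨Λ, hΛ, n, hn⟩ := exists_tsum_iterate_averagedLip_le H.zero hb hε
    have hgn := H.isLipCyl_iterate hg Λ n
    have h1 := hgn.ofReal_abs_integral_sub_le (μ := μ) H.condA
    have h2 := hgn.ofReal_abs_integral_sub_le (μ := ν) H.condA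
    rw [H.integral_iterate hμ hg hΛ n] at h1
    rw [H.integral_iterate hν hg hΛ n, abs_sub_comm] at h2
    refine (ENNReal.ofReal_le_ofReal (abs_sub_le _
      ((averagedMean F G lam R Λ)^[n] g 0) _)).trans ?_
    rw [ENNReal.ofReal_add (abs_nonneg _) (abs_nonneg _), hC, add_mul]
    refine add_le_add (h1.trans ?_) (h2.trans ?_) <;> gcongr
  have hlim : Tendsto (fun ε : ℝ≥0∞ => C * ε) (𝓝[>] 0) (𝓝 (C * 0)) :=
    (ENNReal.Tendsto.const_mul tendsto_id (Or.inr hCtop)).mono_left nhdsWithin_le_nhds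
  rw [mul_zero] at hlim
  have := ge_of_tendsto hlim (eventually_mem_nhdsWithin.mono fun ε hε => key ε hε)
  rw [nonpos_iff_eq_zero, ENNReal.ofReal_eq_zero, abs_nonpos_iff] at this
  exact sub_eq_zero.1 this

/-- Uniqueness. Gibbs measures with finite moment agree on functions that are Lipschitz for the
intrinsic length. These include the thickened indicators of closed sets of finitely many spins, so
all finite-dimensional marginals agree. -/
lemma IsDominated.eq_of_isGibbs (hκ : ∑' i, (κ i : ℝ≥0∞) < 1) (hμ : IsGibbs F G lam μ)
    (hμm : moment F μ < ∞) (hν : IsGibbs F G lam ν) (hνm : moment F ν < ∞) : μ = ν := by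
  have := hμ.prob
  have := hν.prob
  obtain ⟨C, hC⟩ := exists_abs_sub_le_len H.condA
  have hmarg : ∀ s : Finset (Site d), μ.map s.restrict = ν.map s.restrict := by
    intro s
    have hr : Measurable (s.restrict : Config d → s → ℝ) := Finset.measurable_restrict s
    have := Measure.isProbabilityMeasure_map (μ := μ) hr.aemeasurable
    have := Measure.isProbabilityMeasure_map (μ := ν) hr.aemeasurable
    refine ext_of_generate_finite _
      (BorelSpace.measurable_eq.trans borel_eq_generateFrom_isClosed) isPiSystem_isClosed
      (fun t ht => ?_) (by simp)
    have hpos : ∀ n : ℕ, (0 : ℝ) < 1 / (n + 1) := fun n => Nat.one_div_pos_of_nat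
    have hlim := tendsto_one_div_add_atTop_nhds_zero_nat (𝕜 := ℝ)
    have h1 := tendsto_integral_thickenedIndicator_of_isClosed (μ.map s.restrict) ht hpos hlim
    have h2 := tendsto_integral_thickenedIndicator_of_isClosed (ν.map s.restrict) ht hpos hlim
    have heq : ∀ n : ℕ, ∫ z, (thickenedIndicator (hpos n) t z : ℝ) ∂μ.map s.restrict
        = ∫ z, (thickenedIndicator (hpos n) t z : ℝ) ∂ν.map s.restrict := by
      intro n
      have hL := lipschitzWith_thickenedIndicator (hpos n) t
      set φ := thickenedIndicator (hpos n) t with hφ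
      set K := (1 / ((n : ℝ) + 1)).toNNReal⁻¹ with hK
      have hφm : ∀ m : Measure (s → ℝ), AEStronglyMeasurable (fun z => (φ z : ℝ)) m := fun m =>
        (NNReal.continuous_coe.comp φ.continuous).aestronglyMeasurable
      rw [integral_map hr.aemeasurable (hφm _), integral_map hr.aemeasurable (hφm _)]
      have hcyl : IsLipCyl F (fun j => if j ∈ s then K * C else 0)
          fun x : Config d => (φ (s.restrict x) : ℝ) := by
        refine ⟨⟨s, fun x y hxy => ?_⟩, ⟨1, fun x => ?_⟩, fun k x u v => ?_⟩
        · have : s.restrict x = s.restrict y := funext fun i => hxy i i.2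
          simp only [this]
        · rw [NNReal.abs_eq]
          exact NNReal.coe_le_one.2 (thickenedIndicator_le_one (hpos n) t (s.restrict x))
        · simp only
          split_ifs with hk
          · have h3 : dist (φ (s.restrict (Function.update x k u)))
                (φ (s.restrict (Function.update x k v))) ≤ K * |u - v| := by
              refine (hL.dist_le_mul _ _).trans ?_
              gcongr
              refine (dist_pi_le_iff (abs_nonneg _)).2 fun i => ?_
              by_cases hik : (i : Site d) = k
              · simp [Finset.restrict, hik, Real.dist_eq]
              · simp [Finset.restrict, Function.update_of_ne hik]
            rw [NNReal.dist_eq] at h3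
            refine h3.trans ?_
            push_cast
            rw [mul_assoc]
            gcongr
            exact hC u v
          · have : ∀ w, s.restrict (Function.update x k w) = s.restrict x := fun w =>
              funext fun i => Function.update_of_ne (fun h : (i : Site d) = k => hk (h ▸ i.2)) _ _
            simp [this]
      refine H.integral_eq hμ hμm hν hνm hcyl ?_
      rw [tsum_dobrushinSeries]
      refine ENNReal.mul_ne_top (ENNReal.inv_ne_top.2 (tsub_pos_of_lt hκ).ne') ?_
      rw [tsum_eq_sum (s := s) fun j hj => by simp [hj]]
      exact ENNReal.sum_ne_top.2 fun j _ => ENNReal.coe_ne_top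
    simp only [heq] at h1
    exact (measureReal_eq_measureReal_iff).1 (tendsto_nhds_unique h1 h2)
  refine IsProjectiveLimit.unique (P := fun s => ν.map s.restrict) hmarg fun s => rfl

end Main

/-! ### Verification of the hypotheses and summation over translates -/

section Verify

variable {d : ℕ} {F : ℝ → ℝ} {G : Site d → ℝ → ℝ} {D : Site d → Site d → ℝ}

lemma IsInvariantSemimetric.nonneg (hD : IsInvariantSemimetric D) (k j : Site d) : 0 ≤ D k j := by
  have h1 := hD.triangle k j k
  rw [hD.self, hD.symm j k] at h1
  linarith

lemma IsInvariantSemimetric.one_le_expWeight (hD : IsInvariantSemimetric D) (k : Site d) :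
    1 ≤ expWeight D k :=
  ENNReal.one_le_ofReal.2 (Real.one_le_exp (hD.nonneg k 0))

lemma IsInvariantSemimetric.sub_zero_eq (hD : IsInvariantSemimetric D) (i k : Site d) :
    D (i - k) 0 = D i k := by
  simpa using (hD.translate (i - k) 0 k).symm

lemma ofReal_exp_le_mul {s t u : ℝ} (h : s ≤ t + u) :
    ENNReal.ofReal (Real.exp s) ≤ ENNReal.ofReal (Real.exp t) * ENNReal.ofReal (Real.exp u) := by
  rw [← ENNReal.ofReal_mul (Real.exp_pos _).le, ← Real.exp_add]
  exact ENNReal.ofReal_le_ofReal (Real.exp_le_exp.2 h)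

lemma IsInvariantSemimetric.expWeight_sub_le (hD : IsInvariantSemimetric D) (i k l : Site d) :
    expWeight D (i - k) ≤ expWeight D (l - i) * expWeight D (l - k) := by
  refine ofReal_exp_le_mul ?_
  rw [hD.sub_zero_eq, hD.sub_zero_eq, hD.sub_zero_eq, hD.symm l i]
  exact hD.triangle i l k

lemma IsInvariantSemimetric.expWeight_le (hD : IsInvariantSemimetric D) (i k : Site d) :
    expWeight D k ≤ expWeight D i * expWeight D (i - k) := by
  refine ofReal_exp_le_mul ?_
  rw [hD.sub_zero_eq, hD.symm i k, add_comm]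
  exact hD.triangle k i 0

/-- The hypotheses provide a dominated interaction whose coefficients are at most
`lam` times the coupling constants. -/
lemma exists_isDominated (hA : ConditionA F) (hB : ConditionB G) (hC : ConditionC F G) {lam : ℝ}
    (hlam : 0 ≤ lam) (D : Site d → Site d → ℝ) :
    ∃ (R : Finset (Site d)) (κ : Site d → ℝ≥0), IsDominated F G lam R κ ∧
      ∑' i, expWeight D i * κ i ≤ ENNReal.ofReal lam * gammaConst F G D := by
  classical
  obtain ⟨r, hr⟩ := hB.range
  have hfin : (Metric.closedBall (0 : Site d) r).Finite :=
    (isCompact_closedBall (0 : Site d) r).finite_of_discrete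
  set R : Finset (Site d) := hfin.toFinset.erase 0 with hR
  have hR0 : ∀ {j}, j ∈ R → j ≠ 0 := fun hj => Finset.ne_of_mem_erase hj
  set κ : Site d → ℝ≥0 := fun j => if j ∈ R then lam.toNNReal * (coupling F G j).toNNReal else 0
    with hκ
  refine ⟨R, κ, ⟨hA, hlam, fun h => hR0 h rfl, fun j hj hjR x => hr j hj ?_ x,
    fun j hj => hB.contDiff j (hR0 hj), fun j hj => hB.convex j (hR0 hj), ?_,
    fun j hj x y => ?_⟩, ?_⟩
  · by_contra! h
    exact hjR (Finset.mem_erase.2 ⟨hj, by simpa using h⟩)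
  · exact if_neg fun h => hR0 h rfl
  · have hpos : 0 < √(second F x) * √(second F y) :=
      mul_pos (Real.sqrt_pos.2 (hA.second_pos x)) (Real.sqrt_pos.2 (hA.second_pos y))
    have h1 : ENNReal.ofReal (|second (G j) (x - y)| / (√(second F x) * √(second F y)))
        ≤ coupling F G j :=
      le_iSup₂ (f := fun x y => ENNReal.ofReal
        (|second (G j) (x - y)| / (√(second F x) * √(second F y)))) x y
    have h2 := (ENNReal.ofReal_le_iff_le_toReal (hC j (hR0 hj)).ne).1 h1
    rw [div_le_iff₀ hpos] at h2
    simp only [hκ, if_pos hj, NNReal.coe_mul, Real.coe_toNNReal _ hlam]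
    rw [mul_assoc]
    exact mul_le_mul_of_nonneg_left h2 hlam
  · rw [gammaConst, ← ENNReal.tsum_mul_left,
      ← tsum_subtype_eq_of_support_subset (s := {k : Site d | k ≠ 0})]
    · refine ENNReal.tsum_le_tsum fun k => ?_
      have : (κ k : ℝ≥0∞) ≤ ENNReal.ofReal lam * coupling F G k := by
        simp only [hκ]
        split_ifs
        · rw [ENNReal.coe_mul, ENNReal.coe_toNNReal (hC k k.2).ne]; rfl
        · simp
      calc _ ≤ expWeight D k * (ENNReal.ofReal lam * coupling F G k) := by gcongr
        _ = _ := by ring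
    · intro k hk hk0
      refine hk ?_
      rw [hk0]
      simp [hκ, hR]

/-- A `C¹` cylinder function with finite oscillations is Lipschitz for the intrinsic length, with
its oscillations as constants. -/
lemma IsC1bCyl.isLipCyl (hA : ConditionA F) {f : Config d → ℝ} (hf : IsC1bCyl f)
    (hosc : ∀ k, oscillation F k f ≠ ∞) :
    IsLipCyl F (fun k => (oscillation F k f).toNNReal) f := by
  obtain ⟨⟨s, φ, hφ, hfφ⟩, hbdd⟩ := hf
  refine ⟨⟨s, fun x y h => ?_⟩, hbdd, fun k x => ?_⟩
  · rw [hfφ, hfφ]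
    congr 1
    exact funext fun i => h i i.2
  · have hd : Differentiable ℝ fun t => f (Function.update x k t) := by
      simp only [hfφ]
      refine (hφ.differentiable (by norm_num)).comp (differentiable_pi.2 fun i => ?_)
      by_cases hik : (i : Site d) = k
      · simp only [hik, Function.update_self]; exact differentiable_id
      · simp only [Function.update_of_ne hik]; exact differentiable_const _
    refine abs_sub_le_len_of_hasDerivAt hA (fun t => (hd t).hasDerivAt) fun t => ?_
    have h1 : ENNReal.ofReal (|partialDeriv k f (Function.update x k t)| /
        √(second F (Function.update x k t k))) ≤ oscillation F k f :=
      le_iSup (fun x : Config d => ENNReal.ofReal (|partialDeriv k f x| / √(second F (x k)))) _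
    have h2 := (ENNReal.ofReal_le_iff_le_toReal (hosc k)).1 h1
    simp only [partialDeriv, Function.update_idem, Function.update_self] at h2
    rwa [div_le_iff₀ (Real.sqrt_pos.2 (hA.second_pos t))] at h2

lemma IsLipCyl.shift {b : Site d → ℝ≥0} {g : Config d → ℝ} (hg : IsLipCyl F b g) (k : Site d) :
    IsLipCyl F (fun j => b (j - k)) (LatticeGibbs.shift k g) := by
  classical
  obtain ⟨s, hs⟩ := hg.cyl
  obtain ⟨M, hM⟩ := hg.bdd
  refine ⟨⟨s.image fun i => i + k, fun x y h => hs fun i hi => h (i + k) ?_⟩, ⟨M, fun x => hM _⟩,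
    fun j x => ?_⟩
  · simp only [Finset.coe_image]
    exact ⟨i, hi, rfl⟩
  · have e : ∀ t, (fun i => Function.update x j t (i + k))
        = Function.update (fun i => x (i + k)) (j - k) t := by
      intro t
      ext i
      by_cases h : i = j - k
      · subst h; simp
      · have : i + k ≠ j := fun h' => h (eq_sub_of_add_eq h')
        rw [Function.update_of_ne this, Function.update_of_ne h]
    simp only [LatticeGibbs.shift, e]
    exact hg.lip (j - k) _

lemma oscillation_ne_top (hD : IsInvariantSemimetric D) {f : Config d → ℝ}
    (hf : weightedOsc F D f < ∞) (k : Site d) : oscillation F k f ≠ ∞ := by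
  refine ne_top_of_le_ne_top (ENNReal.ne_top_of_tsum_ne_top hf.ne k) ?_
  exact le_mul_of_one_le_left zero_le (hD.one_le_expWeight k)

end Verify

end LatticeGibbs

end

theorem theorem1 {d : ℕ} (F : ℝ → ℝ) (G : Site d → ℝ → ℝ)
    (hA : ConditionA F) (hB : ConditionB G) (hC : ConditionC F G)
    (D : Site d → Site d → ℝ) (hD : IsInvariantSemimetric D)
    (lam : ℝ) (hlam : 0 ≤ lam) (hlam_lt : ENNReal.ofReal lam * gammaConst F G D < 1)
    (hne : ∃ μ : Measure (Config d), IsGibbs F G lam μ ∧ moment F μ < ∞) :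
    ∃ μ : Measure (Config d), (IsGibbs F G lam μ ∧ moment F μ < ∞) ∧
      (∀ ν : Measure (Config d), IsGibbs F G lam ν ∧ moment F ν < ∞ → ν = μ) ∧
      ∀ f g : Config d → ℝ, IsC1bCyl f → IsC1bCyl g →
        weightedOsc F D f < ∞ → weightedOsc F D g < ∞ →
        ∑' k : Site d, expWeight D k *
            ENNReal.ofReal |ProbabilityTheory.covariance f (shift k g) μ|
          ≤ (1 - ENNReal.ofReal lam * gammaConst F G D)⁻¹ *
              (weightedOsc F D f * weightedOsc F D g) := by
  obtain ⟨R, κ, H, hκ⟩ := exists_isDominated hA hB hC hlam D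
  have hκ1 : ∑' i, (κ i : ℝ≥0∞) < 1 := by
    refine lt_of_le_of_lt (ENNReal.tsum_le_tsum fun i => ?_) (hκ.trans_lt hlam_lt)
    exact le_mul_of_one_le_left zero_le (hD.one_le_expWeight i)
  obtain ⟨μ, hμ, hμm⟩ := hne
  refine ⟨μ, ⟨hμ, hμm⟩, fun ν hν => H.eq_of_isGibbs hκ1 hν.1 hν.2 hμ hμm,
    fun f g hf hg hfw hgw => ?_⟩
  have hfo := oscillation_ne_top hD hfw
  have hgo := oscillation_ne_top hD hgw
  have hfL := hf.isLipCyl hA hfo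
  have hgL := hg.isLipCyl hA hgo
  set a : Site d → NNReal := fun k => (oscillation F k f).toNNReal with ha
  set b : Site d → NNReal := fun k => (oscillation F k g).toNNReal with hb
  have hacoe : ∀ k, (a k : ℝ≥0∞) = oscillation F k f := fun k => ENNReal.coe_toNNReal (hfo k)
  have hbcoe : ∀ k, (b k : ℝ≥0∞) = oscillation F k g := fun k => ENNReal.coe_toNNReal (hgo k)
  have hsum : ∀ k, ∑' j, dobrushinSeries κ (fun j => b (j - k)) j ≠ ∞ := by
    intro k
    rw [tsum_dobrushinSeries]
    refine ENNReal.mul_ne_top (ENNReal.inv_ne_top.2 (tsub_pos_of_lt hκ1).ne') ?_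
    refine ne_top_of_le_ne_top hgw.ne ?_
    refine ((Equiv.subRight k).tsum_eq fun j => (b j : ℝ≥0∞)).trans_le ?_
    refine ENNReal.tsum_le_tsum fun j => ?_
    rw [hbcoe]
    exact le_mul_of_one_le_left zero_le (hD.one_le_expWeight j)
  have hB' : ∀ i, ∑' k, expWeight D (i - k) * (b (i - k) : ℝ≥0∞) ≤ weightedOsc F D g := by
    intro i
    refine ((Equiv.subLeft i).tsum_eq fun k => expWeight D k * (b k : ℝ≥0∞)).trans_le ?_
    simp only [hbcoe]
    exact le_rfl
  -- the weight of `k` is split as `e^{D(k,0)} ≤ e^{D(i,0)} e^{D(i,k)}` before summing over `k`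
  calc ∑' k : Site d, expWeight D k *
          ENNReal.ofReal |ProbabilityTheory.covariance f (shift k g) μ|
      ≤ ∑' k, ∑' i, expWeight D i * a i *
          (expWeight D (i - k) * dobrushinSeries κ (fun j => b (j - k)) i) := by
        refine ENNReal.tsum_le_tsum fun k => ?_
        have h1 := H.ofReal_abs_covariance_le hμ hμm hfL (hgL.shift k) (hsum k)
        refine (mul_le_mul_right h1 _).trans ?_
        rw [← ENNReal.tsum_mul_left]
        refine ENNReal.tsum_le_tsum fun i => ?_
        calc _ ≤ expWeight D i * expWeight D (i - k)
              * (a i * dobrushinSeries κ (fun j => b (j - k)) i) := by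
              gcongr
              exact hD.expWeight_le i k
          _ = _ := by ring
    _ = ∑' i, expWeight D i * a i *
          ∑' k, expWeight D (i - k) * dobrushinSeries κ (fun j => b (j - k)) i := by
        rw [ENNReal.tsum_comm]
        simp only [ENNReal.tsum_mul_left]
    _ ≤ ∑' i, expWeight D i * a i *
          ((1 - ENNReal.ofReal lam * gammaConst F G D)⁻¹ * weightedOsc F D g) := by
        refine ENNReal.tsum_le_tsum fun i => mul_le_mul_right ?_ _
        refine (tsum_weight_mul_dobrushinSeries_le hD.expWeight_sub_le
          (fun k j => b (j - k)) hB' i).trans ?_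
        gcongr
    _ = (1 - ENNReal.ofReal lam * gammaConst F G D)⁻¹ *
          (weightedOsc F D f * weightedOsc F D g) := by
        rw [ENNReal.tsum_mul_right]
        simp only [hacoe]
        rw [← weightedOsc]
        ring
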